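/- Let $\mathcal H$ be a separable complex Hilbert space, $\mathcal N$ a bounded self-adjoint operator on $\mathcal H$ with spectrum $\sigma=\sigma(\mathcal N)\subset\mathbb R$, and $\rho$ a density matrix on $\mathcal H$ (a positive operator of trace one). Let $\lambda_\rho$ be the spectral measure of $\mathcal N$ in the state $\rho$, i.e. $\mathrm{tr}(g(\mathcal N)\rho)=\int g\,d\lambda_\rho$ for bounded Borel $g$. Let $\mu$ be a $\sigma$-finite measure on a measurable space $\mathcal X$, and let $V_\xi:\mathbb R\to\mathbb C$, $\xi\in\mathcal X$, be a (jointly) measurable family of bounded functions; write $f(\xi|\nu)=|V_\xi(\nu)|^2$ and suppose $\int_{\mathcal X} f(\xi|\nu)\,d\mu(\xi)=1$ for $\nu\in\sigma$. Put $d\mu_\nu(\xi)=f(\xi|\nu)\,d\mu(\xi)$, let $\mathbb E_\nu$ be the expectation with respect to $\mu_\nu$, and let $l(\nu|\xi)=\log f(\xi|\nu)$. Let $\mathbb P_\rho$ be the probability measure on $\mathcal X^{\mathbb N}$ under which, for every $k$, $(\xi_1,\dots,\xi_k)$ has density $\mathrm{tr}(V_k\rho V_k^*)$ with respect to $\mu^{\otimes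 k}$, where $V_k=V_{\xi_k}(\mathcal N)\cdots V_{\xi_1}(\mathcal N)$. Let $\hat{\mathcal N}_k$ be a maximum likelihood estimator, that is, a measurable choice of a maximiser over $\nu\in\sigma$ of $l_k(\nu)=\frac1k\sum_{j=1}^k l(\nu|\xi_j)$. Assume: (A) for $\nu\neq\nu'$ in $\sigma$ the functions $f(\cdot|\nu)$ and $f(\cdot|\nu')$ are not $\mu$-almost everywhere equal; $f(\xi|\cdot)$ is continuous on $\sigma$ for every $\xi$; and $\sup_{\nu'\in\sigma}|l(\nu'|\cdot)|\in L^1(\mu_\nu)$ for every $\nu\in\sigma$. (B) $f(\xi|\nu)>0$ for all $\xi\in\mathcal X$, $\nu\in\sigma$; $f(\xi|\cdot)$ is twice continuously differentiable on $\mathbb R$ for every $\xi$; and for every $\nu\in\sigma$: there is $g\in L^1(\mu_\nu)$ with $|\partial_\nu^j l(\nu'|\xi)|<g(\xi)$ for $j=1,2$, all $\xi$ and all $\nu'\in\sigma$; $\partial_\nu^j f(\cdot|\nu)\in L^1(\mu)$ and $\int\partial_\nu^j f(\xi|\nu)\,d\mu(\xi)=0$ for $j=1,2$; $\partial_\nu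 l(\nu|\cdot)\in L^2(\mu_\nu)$; and $\mathbb E_\nu[-\partial_\nu^2 l(\nu|\xi)]>0$. (C) the boundary of $\sigma$ in $\mathbb R$ satisfies $\lambda_\rho(\partial\sigma)=0$. Let $F(\nu)=\mathbb E_\nu[(\partial_\nu l(\nu|\xi))^2]$ be the Fisher information. Then $\hat{\mathcal N}_k$ converges $\mathbb P_\rho$-almost surely to a random variable $\hat{\mathcal N}_\infty$ with law $\lambda_\rho$, and, under $\mathbb P_\rho$, $\sqrt k\,(\hat{\mathcal N}_k-\hat{\mathcal N}_\infty)$ converges in distribution, as $k\to\infty$, to the normal law with mean zero and random variance $F(\hat{\mathcal N}_\infty)^{-1}$, i.e. to the mixture $\int_\sigma \mathscr N(0,F(\nu)^{-1})\,d\lambda_\rho(\nu)$. In particular, for every $a\in\mathbb R$, $$\lim_{k\to\infty}\mathbb P_\rho\big(\sqrt k\,(\hat{\mathcal N}_k-\hat{\mathcal N}_\infty)\le a\big)=\int_\sigma \mathscr N(0,F(\nu)^{-1})\big((-\infty,a]\big)\,d\lambda_\rho(\nu).$$ -/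

import Mathlib

open MeasureTheory ProbabilityTheory Filter Topology
open scoped ENNReal NNReal InnerProductSpace CompactlySupported

namespace NonDemolition

noncomputable section

/-! ### Trace, spectral measures and the Borel functional calculus -/

section Operators

variable {H : Type*} [NormedAddCommGroup H] [InnerProductSpace ℂ H] [CompleteSpace H]

/-- An orthonormal (Hilbert) basis of `H`, indexed by a set of vectors of `H`. -/
def stdBasis (H : Type*) [NormedAddCommGroup H] [InnerProductSpace ℂ H] [CompleteSpace H] :
    HilbertBasis (exists_hilbertBasis ℂ H).choose ℂ H :=
  (exists_hilbertBasis ℂ H).choose_spec.choose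

/-- The trace `∑ᵢ ⟨eᵢ, T eᵢ⟩` of an operator. For trace class operators the sum converges
absolutely and does not depend on the orthonormal basis. -/
def trace (T : H →L[ℂ] H) : ℂ := ∑' i, ⟪stdBasis H i, T (stdBasis H i)⟫_ℂ

/-- Density matrices: positive operators of trace one. (An operator with divergent trace sum has
`trace T = 0`, so that such a positive operator is automatically trace class.) -/
structure IsDensityMatrix (ρ : H →L[ℂ] H) : Prop where
  isPositive : ρ.IsPositive
  trace_eq_one : trace ρ = 1

/-- The positive linear functional `g ↦ ⟨ψ, g(N) ψ⟩` on compactly supported continuous functions,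
with `g(N)` given by the continuous functional calculus. -/
def vectorFunctional (N : H →L[ℂ] H) (ψ : H) : C_c(ℝ, ℝ) →ₚ[ℝ] ℝ :=
  PositiveLinearMap.mk₀
    { toFun := fun g => (⟪ψ, cfc (g : ℝ → ℝ) N ψ⟫_ℂ).re
      map_add' := fun g h => by
        have e : cfc (⇑(g + h)) N = cfc (⇑g) N + cfc (⇑h) N :=
          cfc_add (a := N) (⇑g) (⇑h) g.continuous.continuousOn h.continuous.continuousOn
        rw [e]
        simp
      map_smul' := fun c g => by
        have e : cfc (⇑(c • g)) N = c • cfc (⇑g) N :=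
          cfc_smul c (⇑g) N g.continuous.continuousOn
        rw [e]
        simp [inner_smul_right_eq_smul] }
    (fun g hg => by
      have h0 : (0 : H →L[ℂ] H) ≤ cfc (⇑g) N := cfc_nonneg (fun x _ => hg x)
      exact (Complex.le_def.1
        (((ContinuousLinearMap.nonneg_iff_isPositive _).1 h0).inner_nonneg_right ψ)).1)

/-- The spectral measure of `N` in the vector state `ψ`, i.e. the measure `μ_ψ` on `ℝ` with
`∫ g dμ_ψ = ⟨ψ, g(N) ψ⟩` (Riesz–Markov–Kakutani). -/
def vectorSpectralMeasure (N : H →L[ℂ] H) (ψ : H) : Measure ℝ :=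
  RealRMK.rieszMeasure (vectorFunctional N ψ)

/-- `T` is `g(N)` in the sense of the Borel functional calculus:
`⟨ψ, T ψ⟩ = ∫ g dμ_ψ` for all `ψ`. There is at most one such bounded operator `T`, and exactly one
if `N` is self-adjoint and `g` is a bounded Borel function. -/
def IsBorelCalculus (N : H →L[ℂ] H) (g : ℝ → ℂ) (T : H →L[ℂ] H) : Prop :=
  ∀ ψ : H, ⟪ψ, T ψ⟫_ℂ = ∫ ν, g ν ∂(vectorSpectralMeasure N ψ)

open Classical in
/-- The operator `g(N)` (Borel functional calculus). -/
def borelCalculus (N : H →L[ℂ] H) (g : ℝ → ℂ) : H →L[ℂ] H :=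
  if h : ∃ T, IsBorelCalculus N g T then h.choose else 0

/-- `lam` is the spectral measure of `N` with respect to the state `ρ`:
`tr(g(N) ρ) = ∫ g dλ` for all bounded Borel functions `g`. -/
structure IsSpectralMeasure (N ρ : H →L[ℂ] H) (lam : Measure ℝ) : Prop where
  isFinite : IsFiniteMeasure lam
  trace_eq : ∀ g : ℝ → ℂ, Measurable g → (∃ C : ℝ, ∀ ν, ‖g ν‖ ≤ C) →
    trace (borelCalculus N g * ρ) = ∫ ν, g ν ∂lam

open Classical in
/-- The spectral measure `λ_ρ` of `N` with respect to the state `ρ`; it is uniquely determined by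
the defining property `IsSpectralMeasure`. -/
def spectralMeasure (N ρ : H →L[ℂ] H) : Measure ℝ :=
  if h : ∃ lam, IsSpectralMeasure N ρ lam then h.choose else 0

end Operators

/-! ### The law of the measurement outcomes -/

section Outcomes

variable {H : Type*} [NormedAddCommGroup H] [InnerProductSpace ℂ H] [CompleteSpace H]
  {X : Type*} [MeasurableSpace X]

/-- The ordered product `V_{ξ_k} ⋯ V_{ξ_1}` of jump operators. -/
def jumpProd (W : X → H →L[ℂ] H) : (k : ℕ) → (Fin k → X) → H →L[ℂ] H
  | 0, _ => 1
  | k + 1, x => W (x (Fin.last k)) * jumpProd W k (fun i => x i.castSucc)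

/-- `P` is the law on the space of infinite sequences of outcomes whose finite-dimensional
distributions have the densities `tr(V_k ρ V_k^*)` with respect to `μ^{⊗ k}`. -/
def IsOutcomeLaw (μ : Measure X) (W : X → H →L[ℂ] H) (ρ : H →L[ℂ] H)
    (P : Measure (ℕ → X)) : Prop :=
  ∀ (k : ℕ) (E : Set (Fin k → X)), MeasurableSet E →
    P {ω | (fun i : Fin k => ω i) ∈ E} =
      ∫⁻ x in E, ENNReal.ofReal
        (trace (jumpProd W k x * ρ * ContinuousLinearMap.adjoint (jumpProd W k x))).re
        ∂(Measure.pi fun _ : Fin k => μ)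

open Classical in
/-- The measure `ℙ_ρ` on the space of infinite sequences of outcomes, for the jump operators
`V_ξ = V_ξ(N)`; it is uniquely determined by its finite-dimensional distributions. -/
def outcomeLaw (μ : Measure X) (N : H →L[ℂ] H) (V : X → ℝ → ℂ) (ρ : H →L[ℂ] H) :
    Measure (ℕ → X) :=
  if h : ∃ P, IsOutcomeLaw μ (fun ξ => borelCalculus N (V ξ)) ρ P then h.choose else 0

end Outcomes

/-! ### Likelihood and Fisher information -/

section Likelihood

variable {X : Type*} [MeasurableSpace X]

/-- The conditional probability density `f(ξ | ν) = |V_ξ(ν)|²`. -/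
def density (V : X → ℝ → ℂ) (ξ : X) (ν : ℝ) : ℝ := ‖V ξ ν‖ ^ 2

/-- The probability measure `dμ_ν(ξ) = f(ξ | ν) dμ(ξ)`. -/
def condLaw (μ : Measure X) (V : X → ℝ → ℂ) (ν : ℝ) : Measure X :=
  μ.withDensity fun ξ => ENNReal.ofReal (density V ξ ν)

/-- The log-likelihood `l(ν | ξ) = log f(ξ | ν)`, as a function of `ν`. -/
def logLik (V : X → ℝ → ℂ) (ξ : X) (ν : ℝ) : ℝ := Real.log (density V ξ ν)

/-- The log-likelihood `l_k(ν | ω)` of the first `k` outcomes `ω 0, …, ω (k - 1)`. -/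
def logLikAvg (V : X → ℝ → ℂ) (k : ℕ) (ω : ℕ → X) (ν : ℝ) : ℝ :=
  (1 / (k : ℝ)) * ∑ j ∈ Finset.range k, logLik V (ω j) ν

/-- The Fisher information `F(ν) = 𝔼_ν[(∂_ν l(ν | ξ))²]`. -/
def fisher (μ : Measure X) (V : X → ℝ → ℂ) (ν : ℝ) : ℝ :=
  ∫ ξ, (deriv (logLik V ξ) ν) ^ 2 ∂(condLaw μ V ν)

/-- A measurable choice `est k` of maximum likelihood estimators over the parameter set `S`. -/
structure IsMLE (V : X → ℝ → ℂ) (S : Set ℝ) (est : ℕ → (ℕ → X) → ℝ) : Prop where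
  measurable : ∀ k, Measurable (est k)
  mem : ∀ k ω, est k ω ∈ S
  isMax : ∀ k ω, ∀ ν ∈ S, logLikAvg V k ω ν ≤ logLikAvg V k ω (est k ω)

/-- Measurable families of bounded functions `V_ξ`, normalised on the parameter set `S`. -/
structure IsJumpFamily (μ : Measure X) (V : X → ℝ → ℂ) (S : Set ℝ) : Prop where
  measurable : Measurable (Function.uncurry V)
  bounded : ∀ ξ, ∃ C : ℝ, ∀ ν, ‖V ξ ν‖ ≤ C
  normalised : ∀ ν ∈ S, ∫ ξ, density V ξ ν ∂μ = 1

/-- Assumptions for the law of large numbers: integrability, identifiability, continuity and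
dominance. (The logarithm of a vanishing density is not meant here; `CLTAssumption` excludes it.) -/
structure LLNAssumption (μ : Measure X) (V : X → ℝ → ℂ) (S : Set ℝ) : Prop where
  integrable : ∀ ν ∈ S, Integrable (fun ξ => density V ξ ν) μ
  identifiable : ∀ ν ∈ S, ∀ ν' ∈ S, ν ≠ ν' →
    ¬ ((fun ξ => density V ξ ν) =ᵐ[μ] fun ξ => density V ξ ν')
  continuous : ∀ ξ, ContinuousOn (density V ξ) S
  dominated : ∀ ν ∈ S,
    Integrable (fun ξ => ⨆ ν' : S, |logLik V ξ ν'|) (condLaw μ V ν)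

/-- Additional assumptions for the central limit theorem: positivity, `C²` dependence on the
parameter, dominated derivatives of the log-likelihood, differentiation under the integral sign
(the derivatives of the constant `∫ f(ξ | ν) dμ(ξ) = 1` being zero), square-integrable score and
positive information. -/
structure CLTAssumption (μ : Measure X) (V : X → ℝ → ℂ) (S : Set ℝ) : Prop where
  pos : ∀ ν ∈ S, ∀ ξ, 0 < density V ξ ν
  contDiff : ∀ ξ, ContDiff ℝ 2 (density V ξ)
  dominated : ∀ ν ∈ S, ∃ g : X → ℝ, Integrable g (condLaw μ V ν) ∧
    ∀ j ∈ ({1, 2} : Set ℕ), ∀ ξ, ∀ ν' ∈ S, |iteratedDeriv j (logLik V ξ) ν'| < g ξ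
  deriv_integral : ∀ ν ∈ S, ∀ j ∈ ({1, 2} : Set ℕ),
    Integrable (fun ξ => iteratedDeriv j (density V ξ) ν) μ ∧
      ∫ ξ, iteratedDeriv j (density V ξ) ν ∂μ = 0
  score_memLp : ∀ ν ∈ S, MemLp (fun ξ => deriv (logLik V ξ) ν) 2 (condLaw μ V ν)
  info_pos : ∀ ν ∈ S, 0 < ∫ ξ, -iteratedDeriv 2 (logLik V ξ) ν ∂(condLaw μ V ν)

/-- The centred normal law with variance `F(ν)⁻¹`. -/
def limitNormal (μ : Measure X) (V : X → ℝ → ℂ) (ν : ℝ) : Measure ℝ :=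
  gaussianReal 0 (Real.toNNReal (fisher μ V ν)⁻¹)

end Likelihood

end

end NonDemolition

/-! All jump operators are functions of `N`, so applying `V_ξ(N)` to a vector just multiplies its
spectral measure by `f(ξ|ν)`. Summing over the vectors `√ρ eᵢ` gives `tr(V_k ρ V_k*) = ∫ ∏ⱼ f(ξⱼ|ν)
dλ_ρ(ν)`. Hence `ℙ_ρ` is a de Finetti mixture: draw `ν` from `λ_ρ`, then draw independent outcomes
from `μ_ν` (`outcomeLaw_eq_bind`). Since `borelCalculus`, `spectralMeasure` and `outcomeLaw` are
chosen by a defining property, each needs existence and uniqueness; `g(N)` arises as a strong limit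
of continuous functions of `N`.

For fixed `ν` the problem is classical. Consistency (`tendsto_mle_ae`) is Wald's argument: Gibbs'
inequality separates `ν` from any other parameter, a local uniform law of large numbers carries this
to the empirical likelihood, and compactness of the spectrum makes finitely many neighbourhoods
enough. Normality (`tendstoInDistribution_mle`) expands the likelihood equation around `ν`: the
normalised score is asymptotically `N(0, F)`, the averaged curvature tends to `-F`, and Slutsky's
theorem yields `N(0, F⁻¹)`. The likelihood equation needs `ν` interior to the spectrum, which holds
for `λ_ρ`-almost every `ν` because the boundary is null.

Finally (`mixture_limits`), the limsup of the estimators is a single random variable equal to `ν`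
almost surely under each component, so its law is `λ_ρ`, and the componentwise limits integrate by
dominated convergence. -/

namespace NonDemolition

noncomputable section

/-! ### Spectral measures of vectors and the continuous functional calculus -/

section VectorMeasure

variable {H : Type*} [NormedAddCommGroup H] [InnerProductSpace ℂ H] [CompleteSpace H]

instance instRegularVectorSpectralMeasure (N : H →L[ℂ] H) (ψ : H) :
    (vectorSpectralMeasure N ψ).Regular := by
  unfold vectorSpectralMeasure
  infer_instance

theorem integral_compactlySupported_vectorSpectralMeasure (N : H →L[ℂ] H) (ψ : H) (g : C_c(ℝ, ℝ)) :
    ∫ ν, g ν ∂(vectorSpectralMeasure N ψ) = (⟪ψ, cfc (g : ℝ → ℝ) N ψ⟫_ℂ).re :=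
  RealRMK.integral_rieszMeasure _ _

theorem vectorSpectralMeasure_le_of_eq_one (N : H →L[ℂ] H) (ψ : H) {g : C_c(ℝ, ℝ)}
    (hg : ∀ x, 0 ≤ g x) {K : Set ℝ} (hK : IsCompact K) (h1 : ∀ x ∈ K, g x = 1) :
    vectorSpectralMeasure N ψ K ≤ ENNReal.ofReal (⟪ψ, cfc (g : ℝ → ℝ) N ψ⟫_ℂ).re :=
  RealRMK.rieszMeasure_le_of_eq_one (vectorFunctional N ψ) hg hK h1

/-- A compact set off the spectrum carries a Urysohn function that is one on it and zero on the
spectrum; the calculus sends that function to `0`. Inner regularity then exhausts the open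
complement. -/
theorem vectorSpectralMeasure_compl_spectrum (N : H →L[ℂ] H) (ψ : H) :
    vectorSpectralMeasure N ψ (spectrum ℝ N)ᶜ = 0 := by
  have hc : IsCompact (spectrum ℝ N) := spectrum.isCompact N
  rw [hc.isClosed.isOpen_compl.measure_eq_iSup_isCompact]
  simp only [ENNReal.iSup_eq_zero]
  intro K hK hKc
  obtain ⟨f, hf1, hf0, hfc, hf⟩ := exists_continuous_one_zero_of_isCompact hKc hc.isClosed
    (Set.disjoint_left.2 fun x hx => hK hx)
  have h := vectorSpectralMeasure_le_of_eq_one N ψ (g := ⟨f, hfc⟩) (fun x => (hf x).1) hKc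
    (fun x hx => hf1 hx)
  have h2 : cfc (⇑(⟨f, hfc⟩ : C_c(ℝ, ℝ))) N = 0 := by
    rw [← cfc_zero ℝ N]
    exact cfc_congr fun x hx => hf0 hx
  rw [h2] at h
  simpa using h

/-- A compactly supported cutoff function which is one on the spectrum. -/
theorem exists_cutoff (N : H →L[ℂ] H) : ∃ g : C_c(ℝ, ℝ), (∀ x ∈ spectrum ℝ N, g x = 1) := by
  obtain ⟨f, hf1, -, hfc, -⟩ := exists_continuous_one_zero_of_isCompact
    (spectrum.isCompact (𝕜 := ℝ) N) (t := (∅ : Set ℝ)) isClosed_empty (by simp)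
  exact ⟨⟨f, hfc⟩, fun x hx => hf1 hx⟩

theorem ae_mem_spectrum (N : H →L[ℂ] H) (ψ : H) :
    ∀ᵐ ν ∂(vectorSpectralMeasure N ψ), ν ∈ spectrum ℝ N :=
  mem_ae_iff.2 (vectorSpectralMeasure_compl_spectrum N ψ)

instance instIsFiniteMeasureVectorSpectralMeasure (N : H →L[ℂ] H) (ψ : H) :
    IsFiniteMeasure (vectorSpectralMeasure N ψ) where
  measure_univ_lt_top := by
    have hc : IsCompact (spectrum ℝ N) := spectrum.isCompact N
    rw [← Set.union_compl_self (spectrum ℝ N)]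
    refine (measure_union_le _ _).trans_lt ?_
    rw [vectorSpectralMeasure_compl_spectrum, add_zero]
    exact hc.measure_lt_top

theorem integral_vectorSpectralMeasure (N : H →L[ℂ] H) (ψ : H) {g : ℝ → ℝ} (hg : Continuous g) :
    ∫ ν, g ν ∂(vectorSpectralMeasure N ψ) = (⟪ψ, cfc g N ψ⟫_ℂ).re := by
  obtain ⟨χ, hχ⟩ := exists_cutoff N
  -- The cutoff changes neither side, since both see only values on the spectrum.
  let g' : C_c(ℝ, ℝ) := ⟨⟨fun x => g x * χ x, hg.mul χ.continuous⟩, χ.hasCompactSupport.mul_left⟩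
  have e1 : cfc g N = cfc (g' : ℝ → ℝ) N := cfc_congr fun x hx => by
    change g x = g x * χ x
    rw [hχ x hx, mul_one]
  rw [e1, ← integral_compactlySupported_vectorSpectralMeasure]
  refine integral_congr_ae ?_
  filter_upwards [ae_mem_spectrum N ψ] with x hx
  change g x = g x * χ x
  rw [hχ x hx, mul_one]

/-- The operator `c(N)` for a continuous complex function `c` on the real line. -/
def contCalc (N : H →L[ℂ] H) (c : ℝ → ℂ) : H →L[ℂ] H :=
  cfc (fun x => (c x).re) N + Complex.I • cfc (fun x => (c x).im) N

theorem contCalc_sub (N : H →L[ℂ] H) {a b : ℝ → ℂ} (ha : Continuous a) (hb : Continuous b) :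
    contCalc N (fun x => a x - b x) = contCalc N a - contCalc N b := by
  simp only [contCalc, Complex.sub_re, Complex.sub_im]
  rw [cfc_sub (fun x => (a x).re) (fun x => (b x).re) N (by fun_prop) (by fun_prop),
    cfc_sub (fun x => (a x).im) (fun x => (b x).im) N (by fun_prop) (by fun_prop), smul_sub]
  abel

theorem inner_cfc_eq_ofReal (N : H →L[ℂ] H) (ψ : H) (g : ℝ → ℝ) :
    ⟪ψ, cfc g N ψ⟫_ℂ = ((⟪ψ, cfc g N ψ⟫_ℂ).re : ℂ) := by
  have h : IsSelfAdjoint (cfc g N) := cfc_predicate g N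
  have := (ContinuousLinearMap.isSelfAdjoint_iff_isSymmetric.1 h).coe_re_inner_self_apply ψ
  exact this.symm

theorem inner_contCalc (N : H →L[ℂ] H) (ψ : H) {c : ℝ → ℂ} (hc : Continuous c)
    (hb : ∃ C, ∀ x, ‖c x‖ ≤ C) :
    ⟪ψ, contCalc N c ψ⟫_ℂ = ∫ ν, c ν ∂(vectorSpectralMeasure N ψ) := by
  obtain ⟨C, hC⟩ := hb
  have hi : Integrable c (vectorSpectralMeasure N ψ) :=
    Integrable.of_bound hc.aestronglyMeasurable C (ae_of_all _ hC)
  have h1 := integral_vectorSpectralMeasure N ψ (g := fun x => (c x).re) (by fun_prop)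
  have h2 := integral_vectorSpectralMeasure N ψ (g := fun x => (c x).im) (by fun_prop)
  rw [← integral_re_add_im hi]
  simp only [RCLike.re_to_complex, RCLike.im_to_complex, h1, h2]
  simp only [contCalc, add_apply, smul_apply,
    inner_add_right, inner_smul_right]
  rw [inner_cfc_eq_ofReal N ψ (fun x => (c x).re), inner_cfc_eq_ofReal N ψ (fun x => (c x).im)]
  simp [mul_comm]

/-- The real and imaginary parts `R`, `J` of `c(N)` are self-adjoint and commute with each other and
with `h(N)`, so the cross terms of `(R - iJ) h(N) (R + iJ)` cancel and `h(N)(R² + J²)` remains. -/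
theorem adjoint_contCalc_mul_cfc_mul_contCalc (N : H →L[ℂ] H) {c : ℝ → ℂ} (hc : Continuous c)
    {h : ℝ → ℝ} (hh : Continuous h) :
    star (contCalc N c) * cfc h N * contCalc N c = cfc (fun x => h x * ‖c x‖ ^ 2) N := by
  set R := cfc (fun x => (c x).re) N with hR
  set J := cfc (fun x => (c x).im) N with hJ
  have sR : star R = R := (cfc_predicate (p := IsSelfAdjoint) (fun x => (c x).re) N).star_eq
  have sJ : star J = J := (cfc_predicate (p := IsSelfAdjoint) (fun x => (c x).im) N).star_eq
  have cRh : R * cfc h N = cfc h N * R := cfc_commute_cfc _ _ _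
  have cJh : J * cfc h N = cfc h N * J := cfc_commute_cfc _ _ _
  have cRJ : R * J = J * R := cfc_commute_cfc _ _ _
  have e : (fun x => h x * ‖c x‖ ^ 2) =
      fun x => h x * (((c x).re * (c x).re) + ((c x).im * (c x).im)) := by
    funext x
    rw [← Complex.normSq_eq_norm_sq, Complex.normSq_apply]
  rw [e, cfc_mul h (fun x => ((c x).re * (c x).re) + ((c x).im * (c x).im)) N (by fun_prop)
      (by fun_prop),
    cfc_add (a := N) (fun x => (c x).re * (c x).re) (fun x => (c x).im * (c x).im) (by fun_prop)
      (by fun_prop),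
    cfc_mul (fun x => (c x).re) (fun x => (c x).re) N (by fun_prop) (by fun_prop),
    cfc_mul (fun x => (c x).im) (fun x => (c x).im) N (by fun_prop) (by fun_prop), ← hR, ← hJ]
  have e2 : contCalc N c = R + Complex.I • J := rfl
  rw [e2, star_add, star_smul, sR, sJ]
  simp only [RCLike.star_def, Complex.conj_I, add_mul, mul_add, neg_smul, neg_mul, smul_mul_assoc,
    mul_smul_comm, smul_neg, smul_add, smul_smul, Complex.I_mul_I, one_smul]
  have e3 : R * cfc h N * J = J * cfc h N * R := by
    rw [cRh, mul_assoc, cRJ, ← mul_assoc, ← cJh]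
  rw [e3, cRh, cJh, mul_assoc, mul_assoc]
  abel_nf
  simp [mul_assoc]

theorem inner_contCalc_cfc_contCalc (N : H →L[ℂ] H) (ψ : H) {c : ℝ → ℂ} (hc : Continuous c)
    {h : ℝ → ℝ} (hh : Continuous h) :
    (⟪contCalc N c ψ, cfc h N (contCalc N c ψ)⟫_ℂ).re =
      ∫ ν, h ν * ‖c ν‖ ^ 2 ∂(vectorSpectralMeasure N ψ) := by
  rw [integral_vectorSpectralMeasure N ψ (by fun_prop),
    ← adjoint_contCalc_mul_cfc_mul_contCalc N hc hh, ContinuousLinearMap.star_eq_adjoint]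
  simp only [mul_apply_eq_comp, ContinuousLinearMap.adjoint_inner_right]

theorem norm_sq_contCalc (N : H →L[ℂ] H) (hN : IsSelfAdjoint N) (ψ : H) {c : ℝ → ℂ}
    (hc : Continuous c) :
    ‖contCalc N c ψ‖ ^ 2 = ∫ ν, ‖c ν‖ ^ 2 ∂(vectorSpectralMeasure N ψ) := by
  have h := inner_contCalc_cfc_contCalc N ψ hc (h := 1) continuous_one
  rw [cfc_one ℝ N hN] at h
  simp only [one_apply_eq_self, inner_self_eq_norm_sq_to_K] at h
  simp only [Pi.one_apply, one_mul] at h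
  rw [← h]
  norm_cast

theorem vectorSpectralMeasure_real_univ (N : H →L[ℂ] H) (hN : IsSelfAdjoint N) (ψ : H) :
    (vectorSpectralMeasure N ψ).real Set.univ = ‖ψ‖ ^ 2 := by
  have h := integral_vectorSpectralMeasure N ψ (g := 1) continuous_one
  rw [cfc_one ℝ N hN] at h
  simp only [Pi.one_apply, integral_const, smul_eq_mul, mul_one, one_apply_eq_self,
    inner_self_eq_norm_sq_to_K] at h
  rw [h]
  norm_cast

theorem vectorSpectralMeasure_univ (N : H →L[ℂ] H) (hN : IsSelfAdjoint N) (ψ : H) :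
    vectorSpectralMeasure N ψ Set.univ = ‖ψ‖ₑ ^ 2 := by
  rw [← ofReal_measureReal, vectorSpectralMeasure_real_univ N hN, ENNReal.ofReal_pow (by positivity),
    ofReal_norm]

end VectorMeasure

/-! ### Bounded continuous approximation of Borel functions -/

section Approximation

/-- A bounded measurable function is the almost everywhere limit of a uniformly bounded sequence of
continuous functions. -/
theorem exists_continuous_bounded_tendsto_ae (m : Measure ℝ) [IsFiniteMeasure m] {g : ℝ → ℂ}
    (hg : Measurable g) {C : ℝ} (hC : ∀ x, ‖g x‖ ≤ C) :
    ∃ c : ℕ → ℝ → ℂ, (∀ n, Continuous (c n)) ∧ (∃ C', ∀ n x, ‖c n x‖ ≤ C') ∧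
      ∀ᵐ x ∂m, Tendsto (fun n => c n x) atTop (𝓝 (g x)) := by
  have hC0 : 0 ≤ C := (norm_nonneg _).trans (hC 0)
  have hC1 : 0 < C + 1 := by linarith
  have hm : MemLp g 1 m := 
    memLp_one_iff_integrable.2 (Integrable.of_bound hg.aestronglyMeasurable C (ae_of_all _ hC))
  have hex : ∀ n : ℕ, ∃ a : ℝ → ℂ, HasCompactSupport a ∧
      eLpNorm (g - a) 1 m ≤ ((n : ℝ≥0∞) + 1)⁻¹ ∧ Continuous a ∧ MemLp a 1 m := fun n =>
    hm.exists_hasCompactSupport_eLpNorm_sub_le (by simp) (by simp)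
  choose a _ ha hac _ using hex
  have hT : TendstoInMeasure m a atTop g := by
    refine tendstoInMeasure_of_tendsto_eLpNorm one_ne_zero
      (fun n => (hac n).aestronglyMeasurable) hg.aestronglyMeasurable ?_
    refine tendsto_of_tendsto_of_tendsto_of_le_of_le tendsto_const_nhds
      (h := fun n : ℕ => ((n : ℝ≥0∞) + 1)⁻¹) ?_ (fun _ => zero_le) (fun n => ?_)
    · have := ENNReal.tendsto_inv_nat_nhds_zero.comp (tendsto_add_atTop_nat 1)
      refine this.congr fun n => ?_
      simp
    · rw [eLpNorm_sub_comm]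
      exact ha n
  obtain ⟨ns, -, hns⟩ := hT.exists_seq_tendsto_ae
  -- Radial truncation restores a uniform bound while fixing the values of `g`. The radius `C + 1`
  -- keeps the denominator positive even when `C = 0`.
  let tr : ℂ → ℂ := fun z => ((C + 1) / max (C + 1) ‖z‖) • z
  have hpos : ∀ z : ℂ, 0 < max (C + 1) ‖z‖ := fun z => lt_max_of_lt_left hC1
  have htr : Continuous tr := by
    refine Continuous.smul (Continuous.div continuous_const (by fun_prop) fun z => (hpos z).ne')
      continuous_id
  have htrb : ∀ z, ‖tr z‖ ≤ C + 1 := fun z => by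
    simp only [tr, norm_smul, norm_div, Real.norm_eq_abs, abs_of_pos hC1, abs_of_pos (hpos z)]
    rw [div_mul_eq_mul_div, div_le_iff₀ (hpos z)]
    exact mul_le_mul_of_nonneg_left (le_max_right _ _) hC1.le
  have htrg : ∀ x, tr (g x) = g x := fun x => by
    simp only [tr]
    rw [max_eq_left ((hC x).trans (by linarith)), div_self hC1.ne', one_smul]
  refine ⟨fun n x => tr (a (ns n) x), fun n => htr.comp (hac _), ⟨C + 1, fun n x => htrb _⟩, ?_⟩
  filter_upwards [hns] with x hx
  have := (htr.tendsto (g x)).comp hx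
  rwa [htrg] at this

end Approximation

/-! ### Construction of the Borel functional calculus -/

section BorelCalculus

variable {H : Type*} [NormedAddCommGroup H] [InnerProductSpace ℂ H] [CompleteSpace H]

/-- The map `c ↦ c(N) ψ` is isometric for the `L²` norm of the spectral measure, so bounded almost
everywhere convergence gives norm convergence. The general filter also covers pairs of indices, as
the Cauchy property requires. -/
theorem tendsto_contCalc_sub (N : H →L[ℂ] H) (hN : IsSelfAdjoint N) (ψ : H) {ι : Type*}
    {l : Filter ι} [l.IsCountablyGenerated] {a b : ι → ℝ → ℂ} (ha : ∀ i, Continuous (a i))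
    (hb : ∀ i, Continuous (b i)) {C C' : ℝ} (hC : ∀ i x, ‖a i x‖ ≤ C) (hC' : ∀ i x, ‖b i x‖ ≤ C')
    (hlim : ∀ᵐ x ∂(vectorSpectralMeasure N ψ), Tendsto (fun i => a i x - b i x) l (𝓝 0)) :
    Tendsto (fun i => ‖contCalc N (a i) ψ - contCalc N (b i) ψ‖) l (𝓝 0) := by
  have h1 : Tendsto (fun i => ‖contCalc N (a i) ψ - contCalc N (b i) ψ‖ ^ 2) l (𝓝 0) := by
    have e : ∀ i, ‖contCalc N (a i) ψ - contCalc N (b i) ψ‖ ^ 2 =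
        ∫ ν, ‖a i ν - b i ν‖ ^ 2 ∂(vectorSpectralMeasure N ψ) := fun i => by
      have := norm_sq_contCalc N hN ψ (c := fun x => a i x - b i x) ((ha i).sub (hb i))
      rw [← this, contCalc_sub N (ha i) (hb i)]
      rfl
    simp only [e]
    have := tendsto_integral_filter_of_dominated_convergence (μ := vectorSpectralMeasure N ψ)
      (l := l) (F := fun i ν => ‖a i ν - b i ν‖ ^ 2) (f := fun _ => (0 : ℝ))
      (fun _ => (C + C') ^ 2)
      (Eventually.of_forall fun i => (by
        have := ha i; have := hb i
        exact Continuous.aestronglyMeasurable (by fun_prop)))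
      (Eventually.of_forall fun i => ae_of_all _ fun x => by
        rw [Real.norm_of_nonneg (by positivity)]
        exact pow_le_pow_left₀ (norm_nonneg _)
          ((norm_sub_le _ _).trans (add_le_add (hC i x) (hC' i x))) 2)
      (integrable_const _) (by
        filter_upwards [hlim] with x hx
        simpa using hx.norm.pow 2)
    simpa using this
  have := h1.sqrt
  simpa using this

/-- `χ = g(N) ψ`, as the limit along all bounded continuous approximations of `g`. -/
def IsBorelLimit (N : H →L[ℂ] H) (g : ℝ → ℂ) (ψ χ : H) : Prop :=
  ∀ c : ℕ → ℝ → ℂ, (∀ n, Continuous (c n)) → (∃ C, ∀ n x, ‖c n x‖ ≤ C) →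
    (∀ᵐ x ∂(vectorSpectralMeasure N ψ), Tendsto (fun n => c n x) atTop (𝓝 (g x))) →
    Tendsto (fun n => contCalc N (c n) ψ) atTop (𝓝 χ)

theorem exists_isBorelLimit (N : H →L[ℂ] H) (hN : IsSelfAdjoint N) (ψ : H) {g : ℝ → ℂ}
    (hg : Measurable g) {C : ℝ} (hC : ∀ x, ‖g x‖ ≤ C) : ∃ χ, IsBorelLimit N g ψ χ := by
  obtain ⟨a, hac, ⟨C', ha⟩, hlim⟩ :=
    exists_continuous_bounded_tendsto_ae (vectorSpectralMeasure N ψ) hg hC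
  have hcs : CauchySeq fun n => contCalc N (a n) ψ := by
    rw [cauchySeq_iff_tendsto_dist_atTop_0]
    simp only [dist_eq_norm]
    refine tendsto_contCalc_sub N hN ψ (a := fun p : ℕ × ℕ => a p.1) (b := fun p => a p.2)
      (fun p => hac _) (fun p => hac _) (fun p => ha _) (fun p => ha _) ?_
    filter_upwards [hlim] with x hx
    have h1 : Tendsto (fun p : ℕ × ℕ => a p.1 x) atTop (𝓝 (g x)) := by
      rw [← prod_atTop_atTop_eq]; exact hx.comp tendsto_fst
    have h2 : Tendsto (fun p : ℕ × ℕ => a p.2 x) atTop (𝓝 (g x)) := by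
      rw [← prod_atTop_atTop_eq]; exact hx.comp tendsto_snd
    simpa using h1.sub h2
  obtain ⟨χ, hχ⟩ := cauchySeq_tendsto_of_complete hcs
  refine ⟨χ, fun c hc ⟨C'', hC''⟩ hcl => ?_⟩
  have h0 := tendsto_contCalc_sub N hN ψ (l := atTop) hc hac hC'' ha (by
    filter_upwards [hlim, hcl] with x hx hx'
    simpa using hx'.sub hx)
  have := (tendsto_zero_iff_norm_tendsto_zero.2 h0).add hχ
  simpa using this

theorem exists_isBorelLimit_operator (N : H →L[ℂ] H) (hN : IsSelfAdjoint N) {g : ℝ → ℂ}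
    (hg : Measurable g) {C : ℝ} (hC : ∀ x, ‖g x‖ ≤ C) :
    ∃ T : H →L[ℂ] H, ∀ ψ, IsBorelLimit N g ψ (T ψ) := by
  choose T hT using fun ψ => exists_isBorelLimit N hN ψ hg hC
  have hC0 : 0 ≤ C := (norm_nonneg _).trans (hC 0)
  let L : H →ₗ[ℂ] H :=
    { toFun := T
      map_add' := fun φ ψ => by
        -- Approximating with respect to the sum of the measures gives one sequence valid for all
        -- the vectors at once; linearity then passes to the limit.
        obtain ⟨a, hac, hab, hlim⟩ := exists_continuous_bounded_tendsto_ae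
          (vectorSpectralMeasure N φ + (vectorSpectralMeasure N ψ +
            vectorSpectralMeasure N (φ + ψ))) hg hC
        rw [ae_add_measure_iff, ae_add_measure_iff] at hlim
        have h1 := hT φ a hac hab hlim.1
        have h2 := hT ψ a hac hab hlim.2.1
        have h3 := hT (φ + ψ) a hac hab hlim.2.2
        simp only [map_add] at h3
        exact tendsto_nhds_unique h3 (h1.add h2)
      map_smul' := fun z ψ => by
        obtain ⟨a, hac, hab, hlim⟩ := exists_continuous_bounded_tendsto_ae
          (vectorSpectralMeasure N ψ + vectorSpectralMeasure N (z • ψ)) hg hC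
        rw [ae_add_measure_iff] at hlim
        have h1 := hT ψ a hac hab hlim.1
        have h2 := hT (z • ψ) a hac hab hlim.2
        simp only [map_smul] at h2
        exact tendsto_nhds_unique h2 (h1.const_smul z) }
  refine ⟨L.mkContinuousOfExistsBound ?_, fun ψ => hT ψ⟩
  refine ⟨C, fun ψ => ?_⟩
  obtain ⟨a, hac, ⟨C', ha⟩, hlim⟩ := exists_continuous_bounded_tendsto_ae
    (vectorSpectralMeasure N ψ) hg hC
  have h1 : Tendsto (fun n => ‖contCalc N (a n) ψ‖ ^ 2) atTop (𝓝 (‖T ψ‖ ^ 2)) :=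
    (hT ψ a hac ⟨C', ha⟩ hlim).norm.pow 2
  simp only [norm_sq_contCalc N hN ψ (hac _)] at h1
  have h2 : Tendsto (fun n => ∫ ν, ‖a n ν‖ ^ 2 ∂(vectorSpectralMeasure N ψ)) atTop
      (𝓝 (∫ ν, ‖g ν‖ ^ 2 ∂(vectorSpectralMeasure N ψ))) := by
    refine tendsto_integral_filter_of_dominated_convergence (fun _ => C' ^ 2)
      (Eventually.of_forall fun i => by
        have := hac i
        exact Continuous.aestronglyMeasurable (by fun_prop))
      (Eventually.of_forall fun i => ae_of_all _ fun x => ?_) (integrable_const _) ?_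
    · rw [Real.norm_of_nonneg (by positivity)]
      exact pow_le_pow_left₀ (norm_nonneg _) (ha i x) 2
    · filter_upwards [hlim] with x hx
      exact hx.norm.pow 2
  have h3 : ‖T ψ‖ ^ 2 ≤ (C * ‖ψ‖) ^ 2 := by
    rw [tendsto_nhds_unique h1 h2, mul_pow, ← vectorSpectralMeasure_real_univ N hN]
    refine (integral_mono_of_nonneg (ae_of_all _ fun x => by positivity)
      (integrable_const (C ^ 2)) (ae_of_all _ fun x => ?_)).trans (le_of_eq ?_)
    · exact pow_le_pow_left₀ (norm_nonneg _) (hC x) 2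
    · simp [mul_comm]
  exact abs_le_of_sq_le_sq' h3 (by positivity) |>.2

theorem isBorelCalculus_of_isBorelLimit (N : H →L[ℂ] H) {g : ℝ → ℂ}
    (hg : Measurable g) {C : ℝ} (hC : ∀ x, ‖g x‖ ≤ C) {T : H →L[ℂ] H}
    (hT : ∀ ψ, IsBorelLimit N g ψ (T ψ)) : IsBorelCalculus N g T := fun ψ => by
  obtain ⟨a, hac, ⟨C', ha⟩, hlim⟩ := exists_continuous_bounded_tendsto_ae
    (vectorSpectralMeasure N ψ) hg hC
  have h1 : Tendsto (fun n => ⟪ψ, contCalc N (a n) ψ⟫_ℂ) atTop (𝓝 ⟪ψ, T ψ⟫_ℂ) :=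
    tendsto_const_nhds.inner (hT ψ a hac ⟨C', ha⟩ hlim)
  simp only [inner_contCalc N ψ (hac _) ⟨C', ha _⟩] at h1
  refine tendsto_nhds_unique h1 (tendsto_integral_filter_of_dominated_convergence (fun _ => C')
    (Eventually.of_forall fun i => (hac i).aestronglyMeasurable)
    (Eventually.of_forall fun i => ae_of_all _ fun x => ha i x) (integrable_const _) hlim)

/-- By complex polarisation, a bounded operator is determined by its quadratic form. -/
theorem IsBorelCalculus.unique {N : H →L[ℂ] H} {g : ℝ → ℂ} {S T : H →L[ℂ] H}
    (hS : IsBorelCalculus N g S) (hT : IsBorelCalculus N g T) : S = T := by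
  have h : (S : H →ₗ[ℂ] H) = (T : H →ₗ[ℂ] H) := by
    rw [← ext_inner_map]
    intro x
    have := (hS x).trans (hT x).symm
    rw [← inner_conj_symm, ← inner_conj_symm ((T : H →ₗ[ℂ] H) x)]
    exact congrArg _ this
  exact ContinuousLinearMap.coe_injective h

theorem isBorelLimit_borelCalculus (N : H →L[ℂ] H) (hN : IsSelfAdjoint N) {g : ℝ → ℂ}
    (hg : Measurable g) (hb : ∃ C, ∀ x, ‖g x‖ ≤ C) (ψ : H) :
    IsBorelLimit N g ψ (borelCalculus N g ψ) := by
  obtain ⟨C, hC⟩ := hb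
  obtain ⟨T, hT⟩ := exists_isBorelLimit_operator N hN hg hC
  have hTB := isBorelCalculus_of_isBorelLimit N hg hC hT
  have hex : ∃ T, IsBorelCalculus N g T := ⟨T, hTB⟩
  have : borelCalculus N g = T := by
    rw [borelCalculus, dif_pos hex]
    exact hex.choose_spec.unique hTB
  rw [this]
  exact hT ψ

theorem isBorelCalculus_borelCalculus (N : H →L[ℂ] H) (hN : IsSelfAdjoint N) {g : ℝ → ℂ}
    (hg : Measurable g) (hb : ∃ C, ∀ x, ‖g x‖ ≤ C) :
    IsBorelCalculus N g (borelCalculus N g) := by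
  obtain ⟨C, hC⟩ := hb
  exact isBorelCalculus_of_isBorelLimit N hg hC
    (fun ψ => isBorelLimit_borelCalculus N hN hg ⟨C, hC⟩ ψ)

/-- The spectral measure of the vector `g(N) ψ` has density `|g|²` with respect to that of `ψ`. -/
theorem vectorSpectralMeasure_borelCalculus (N : H →L[ℂ] H) (hN : IsSelfAdjoint N) {g : ℝ → ℂ}
    (hg : Measurable g) (hb : ∃ C, ∀ x, ‖g x‖ ≤ C) (ψ : H) :
    vectorSpectralMeasure N (borelCalculus N g ψ) =
      (vectorSpectralMeasure N ψ).withDensity fun ν => ENNReal.ofReal (‖g ν‖ ^ 2) := by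
  obtain ⟨C, hC⟩ := hb
  have hgi : Integrable (fun ν => ‖g ν‖ ^ 2) (vectorSpectralMeasure N ψ) :=
    Integrable.of_bound (by fun_prop) (C ^ 2) (ae_of_all _ fun x => by
      rw [Real.norm_of_nonneg (by positivity)]
      exact pow_le_pow_left₀ (norm_nonneg _) (hC x) 2)
  have : IsFiniteMeasure
      ((vectorSpectralMeasure N ψ).withDensity fun ν => ENNReal.ofReal (‖g ν‖ ^ 2)) :=
    isFiniteMeasure_withDensity_ofReal hgi.2
  -- Test against `h ∈ C_c`: for continuous `c` the identity is `inner_contCalc_cfc_contCalc`, and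
  -- both sides pass to the limit along approximations of `g`.
  refine Measure.ext_of_integral_eq_on_compactlySupported fun h => ?_
  obtain ⟨M, hM⟩ := h.hasCompactSupport.exists_bound_of_continuous h.continuous
  obtain ⟨a, hac, ⟨C', ha⟩, hlim⟩ := exists_continuous_bounded_tendsto_ae
    (vectorSpectralMeasure N ψ) hg hC
  have ht := isBorelLimit_borelCalculus N hN hg ⟨C, hC⟩ ψ a hac ⟨C', ha⟩ hlim
  have h1 : Tendsto (fun n => (⟪contCalc N (a n) ψ, cfc (h : ℝ → ℝ) N (contCalc N (a n) ψ)⟫_ℂ).re)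
      atTop (𝓝 (⟪borelCalculus N g ψ, cfc (h : ℝ → ℝ) N (borelCalculus N g ψ)⟫_ℂ).re) :=
    (Complex.continuous_re.tendsto _).comp
      (ht.inner (((cfc (h : ℝ → ℝ) N).continuous.tendsto _).comp ht))
  have e : ∀ n, (⟪contCalc N (a n) ψ, cfc (h : ℝ → ℝ) N (contCalc N (a n) ψ)⟫_ℂ).re =
      ∫ ν, h ν * ‖a n ν‖ ^ 2 ∂(vectorSpectralMeasure N ψ) := fun n =>
    inner_contCalc_cfc_contCalc N ψ (hac n) h.continuous
  simp only [e] at h1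
  rw [integral_compactlySupported_vectorSpectralMeasure,
    integral_withDensity_eq_integral_toReal_smul (by fun_prop) (ae_of_all _ fun x => by simp)]
  have h2 : Tendsto (fun n => ∫ ν, h ν * ‖a n ν‖ ^ 2 ∂(vectorSpectralMeasure N ψ)) atTop
      (𝓝 (∫ ν, h ν * ‖g ν‖ ^ 2 ∂(vectorSpectralMeasure N ψ))) := by
    refine tendsto_integral_filter_of_dominated_convergence (fun _ => M * C' ^ 2)
      (Eventually.of_forall fun i => by
        have := hac i
        have := h.continuous
        exact Continuous.aestronglyMeasurable (by fun_prop))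
      (Eventually.of_forall fun i => ae_of_all _ fun x => ?_) (integrable_const _) ?_
    · rw [norm_mul, norm_pow, norm_norm]
      exact mul_le_mul (hM x) (pow_le_pow_left₀ (norm_nonneg _) (ha i x) 2) (by positivity)
        ((norm_nonneg _).trans (hM x))
    · filter_upwards [hlim] with x hx
      exact (hx.norm.pow 2).const_mul _
  rw [tendsto_nhds_unique h1 h2]
  refine integral_congr_ae (ae_of_all _ fun x => ?_)
  dsimp only
  rw [ENNReal.toReal_ofReal (by positivity), smul_eq_mul, mul_comm]

end BorelCalculus

/-! ### Hilbert–Schmidt sums, traces and the spectral measure of a state -/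

section Trace

/-- Parseval in `[0, ∞]`, where double sums may be exchanged without a summability proof. -/
theorem enorm_sq_eq_tsum_inner {H : Type*} [NormedAddCommGroup H] [InnerProductSpace ℂ H]
    {ι : Type*} (b : HilbertBasis ι ℂ H) (x : H) :
    ‖x‖ₑ ^ 2 = ∑' i, ‖⟪b i, x⟫_ℂ‖ₑ ^ 2 := by
  have h := b.hasSum_inner_mul_inner x x
  have e : ∀ i, ⟪x, b i⟫_ℂ * ⟪b i, x⟫_ℂ = ((‖⟪b i, x⟫_ℂ‖ ^ 2 : ℝ) : ℂ) := fun i => by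
    rw [← inner_conj_symm x (b i), Complex.conj_mul']
    simp
  have e2 : ⟪x, x⟫_ℂ = ((‖x‖ ^ 2 : ℝ) : ℂ) := by
    rw [inner_self_eq_norm_sq_to_K]
    simp
  simp only [e, e2] at h
  have h' := Complex.hasSum_ofReal.1 h
  have h2 := ENNReal.ofReal_tsum_of_nonneg (fun i => by positivity) h'.summable
  rw [h'.tsum_eq] at h2
  simpa [ENNReal.ofReal_pow] using h2

theorem summable_matrix_sq {H : Type*} [NormedAddCommGroup H] [InnerProductSpace ℂ H] {ι : Type*}
    (b : HilbertBasis ι ℂ H) {A : H →L[ℂ] H}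
    (hA : ∑' i, ‖A (b i)‖ₑ ^ 2 ≠ ∞) :
    Summable fun p : ι × ι => ‖⟪b p.1, A (b p.2)⟫_ℂ‖ ^ 2 := by
  have h : ∑' p : ι × ι, ‖⟪b p.1, A (b p.2)⟫_ℂ‖ₑ ^ 2 ≠ ∞ := by
    rw [ENNReal.tsum_prod (f := fun i j => ‖⟪b i, A (b j)⟫_ℂ‖ₑ ^ 2), ENNReal.tsum_comm]
    simpa only [fun x : H => enorm_sq_eq_tsum_inner b x] using hA
  have := ENNReal.summable_toReal h
  simpa using this

variable {H : Type*} [NormedAddCommGroup H] [InnerProductSpace ℂ H] [CompleteSpace H]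

theorem tsum_enorm_sq_adjoint {ι : Type*} (b : HilbertBasis ι ℂ H) (A : H →L[ℂ] H) :
    ∑' i, ‖ContinuousLinearMap.adjoint A (b i)‖ₑ ^ 2 = ∑' i, ‖A (b i)‖ₑ ^ 2 := by
  simp only [fun x : H => enorm_sq_eq_tsum_inner b x, ContinuousLinearMap.adjoint_inner_right]
  rw [ENNReal.tsum_comm]
  refine tsum_congr fun i => tsum_congr fun j => ?_
  rw [← ofReal_norm, ← ofReal_norm, norm_inner_symm]

/-- Cyclicity of the trace for Hilbert–Schmidt operators. -/
theorem trace_mul_comm {A B : H →L[ℂ] H} (hA : ∑' i, ‖A (stdBasis H i)‖ₑ ^ 2 ≠ ∞)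
    (hB : ∑' i, ‖B (stdBasis H i)‖ₑ ^ 2 ≠ ∞) : trace (A * B) = trace (B * A) := by
  set b := stdBasis H
  have key : ∀ (A B : H →L[ℂ] H) i, ⟪b i, (A * B) (b i)⟫_ℂ =
      ∑' j, ⟪b i, A (b j)⟫_ℂ * ⟪b j, B (b i)⟫_ℂ := fun A B i => by
    rw [mul_apply_eq_comp, ← ContinuousLinearMap.adjoint_inner_left, ← b.tsum_inner_mul_inner]
    simp only [ContinuousLinearMap.adjoint_inner_left]
  simp only [trace]
  change ∑' i, ⟪b i, (A * B) (b i)⟫_ℂ = ∑' i, ⟪b i, (B * A) (b i)⟫_ℂ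
  simp only [key]
  -- Each product is bounded by `|a|² + |b|²`, so the double series converges absolutely and may be
  -- reordered.
  have hs : Summable (Function.uncurry fun i j => ⟪b i, A (b j)⟫_ℂ * ⟪b j, B (b i)⟫_ℂ) := by
    have h1 := summable_matrix_sq b hA
    have h2 := (summable_matrix_sq b hB).prod_symm
    refine Summable.of_norm_bounded (h1.add h2) fun p => ?_
    simp only [Function.uncurry, norm_mul, Prod.fst_swap, Prod.snd_swap]
    nlinarith [sq_nonneg (‖⟪b p.1, A (b p.2)⟫_ℂ‖ - ‖⟪b p.2, B (b p.1)⟫_ℂ‖),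
      sq_nonneg ‖⟪b p.1, A (b p.2)⟫_ℂ‖, sq_nonneg ‖⟪b p.2, B (b p.1)⟫_ℂ‖]
  refine hs.tsum_comm.symm.trans ?_
  exact tsum_congr fun i => tsum_congr fun j => mul_comm _ _

theorem IsDensityMatrix.sqrt_mul_sqrt {ρ : H →L[ℂ] H} (hρ : IsDensityMatrix ρ) :
    CFC.sqrt ρ * CFC.sqrt ρ = ρ :=
  CFC.sqrt_mul_sqrt_self ρ ((ContinuousLinearMap.nonneg_iff_isPositive _).2 hρ.isPositive)

theorem adjoint_sqrt (ρ : H →L[ℂ] H) :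
    ContinuousLinearMap.adjoint (CFC.sqrt ρ) = CFC.sqrt ρ :=
  (IsSelfAdjoint.of_nonneg (CFC.sqrt_nonneg ρ)).star_eq

theorem inner_mul_adjoint_self (A : H →L[ℂ] H) (x : H) :
    ⟪x, (A * ContinuousLinearMap.adjoint A) x⟫_ℂ =
      ((‖ContinuousLinearMap.adjoint A x‖ ^ 2 : ℝ) : ℂ) := by
  rw [mul_apply_eq_comp, ← ContinuousLinearMap.adjoint_inner_left, inner_self_eq_norm_sq_to_K]
  simp

theorem trace_mul_adjoint_self (A : H →L[ℂ] H) :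
    trace (A * ContinuousLinearMap.adjoint A) =
      ((∑' i, ‖ContinuousLinearMap.adjoint A (stdBasis H i)‖ ^ 2 : ℝ) : ℂ) := by
  simp only [trace, inner_mul_adjoint_self, Complex.ofReal_tsum]

theorem IsDensityMatrix.tsum_enorm_sqrt {ρ : H →L[ℂ] H} (hρ : IsDensityMatrix ρ) :
    ∑' i, ‖CFC.sqrt ρ (stdBasis H i)‖ₑ ^ 2 = 1 := by
  have h := trace_mul_adjoint_self (CFC.sqrt ρ)
  rw [adjoint_sqrt, hρ.sqrt_mul_sqrt, hρ.trace_eq_one] at h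
  have h1 : ∑' i, ‖CFC.sqrt ρ (stdBasis H i)‖ ^ 2 = 1 := by exact_mod_cast h.symm
  have hs : Summable fun i => ‖CFC.sqrt ρ (stdBasis H i)‖ ^ 2 := by
    -- A divergent real series has sum `0` by convention, which contradicts trace one.
    by_contra hn
    rw [tsum_eq_zero_of_not_summable hn] at h1
    exact zero_ne_one h1
  have h2 := ENNReal.ofReal_tsum_of_nonneg (fun i => by positivity) hs
  rw [h1] at h2
  simpa [ENNReal.ofReal_pow] using h2.symm

theorem tsum_enorm_sq_mul_le {A B : H →L[ℂ] H} :
    ∑' i, ‖(A * B) (stdBasis H i)‖ₑ ^ 2 ≤ ‖A‖ₑ ^ 2 * ∑' i, ‖B (stdBasis H i)‖ₑ ^ 2 := by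
  rw [← ENNReal.tsum_mul_left]
  refine ENNReal.tsum_le_tsum fun i => ?_
  rw [← mul_pow]
  exact pow_le_pow_left' (A.le_opENorm _) 2

theorem IsDensityMatrix.tsum_enorm_mul_sqrt_ne_top {ρ : H →L[ℂ] H} (hρ : IsDensityMatrix ρ)
    (A : H →L[ℂ] H) : ∑' i, ‖(A * CFC.sqrt ρ) (stdBasis H i)‖ₑ ^ 2 ≠ ∞ := by
  refine ne_top_of_le_ne_top ?_ tsum_enorm_sq_mul_le
  rw [hρ.tsum_enorm_sqrt, mul_one]
  exact ENNReal.pow_ne_top enorm_ne_top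

/-- Split `ρ = √ρ √ρ` into Hilbert–Schmidt factors and cycle one of them. The state becomes a sum of
the vector states `√ρ eᵢ`. -/
theorem IsDensityMatrix.trace_mul {ρ : H →L[ℂ] H} (hρ : IsDensityMatrix ρ) (T : H →L[ℂ] H) :
    trace (T * ρ) = ∑' i, ⟪CFC.sqrt ρ (stdBasis H i), T (CFC.sqrt ρ (stdBasis H i))⟫_ℂ := by
  have h1 : T * ρ = (T * CFC.sqrt ρ) * CFC.sqrt ρ := by rw [mul_assoc, hρ.sqrt_mul_sqrt]
  rw [h1, trace_mul_comm (hρ.tsum_enorm_mul_sqrt_ne_top T) (by rw [hρ.tsum_enorm_sqrt]; simp)]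
  simp only [trace]
  refine tsum_congr fun i => ?_
  rw [mul_apply_eq_comp, ← ContinuousLinearMap.adjoint_inner_left, adjoint_sqrt, mul_apply_eq_comp]

/-- With `B = A √ρ` the operator is `B B*`, and `B*` has the same Hilbert–Schmidt norm as `B`. -/
theorem IsDensityMatrix.ofReal_trace_conj {ρ : H →L[ℂ] H} (hρ : IsDensityMatrix ρ)
    (A : H →L[ℂ] H) :
    ENNReal.ofReal (trace (A * ρ * ContinuousLinearMap.adjoint A)).re =
      ∑' i, ‖A (CFC.sqrt ρ (stdBasis H i))‖ₑ ^ 2 := by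
  have h1 : A * ρ * ContinuousLinearMap.adjoint A =
      (A * CFC.sqrt ρ) * ContinuousLinearMap.adjoint (A * CFC.sqrt ρ) := by
    have : ContinuousLinearMap.adjoint (A * CFC.sqrt ρ) =
        CFC.sqrt ρ * ContinuousLinearMap.adjoint A := by
      rw [← ContinuousLinearMap.star_eq_adjoint, star_mul]
      simp only [ContinuousLinearMap.star_eq_adjoint, adjoint_sqrt]
    rw [this, ← mul_assoc, mul_assoc A (CFC.sqrt ρ), hρ.sqrt_mul_sqrt]
  have hne := hρ.tsum_enorm_mul_sqrt_ne_top A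
  have had := tsum_enorm_sq_adjoint (stdBasis H) (A * CFC.sqrt ρ)
  rw [← had] at hne
  have hs := ENNReal.summable_toReal hne
  rw [h1, trace_mul_adjoint_self, Complex.ofReal_re]
  simp only [ENNReal.toReal_pow, toReal_enorm] at hs
  rw [ENNReal.ofReal_tsum_of_nonneg (fun i => by positivity) hs]
  simp only [ENNReal.ofReal_pow (norm_nonneg _), ofReal_norm]
  rw [had]
  simp only [mul_apply_eq_comp]

/-- The spectral measure in the state `ρ`, as the sum of the vector measures of `√ρ eᵢ`. -/
def sumSpectralMeasure (N ρ : H →L[ℂ] H) : Measure ℝ :=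
  Measure.sum fun i => vectorSpectralMeasure N (CFC.sqrt ρ (stdBasis H i))

theorem sumSpectralMeasure_univ {N ρ : H →L[ℂ] H} (hN : IsSelfAdjoint N)
    (hρ : IsDensityMatrix ρ) : sumSpectralMeasure N ρ Set.univ = 1 := by
  rw [sumSpectralMeasure, Measure.sum_apply _ MeasurableSet.univ]
  simp only [vectorSpectralMeasure_univ N hN]
  exact hρ.tsum_enorm_sqrt

theorem isSpectralMeasure_sum {N ρ : H →L[ℂ] H} (hN : IsSelfAdjoint N)
    (hρ : IsDensityMatrix ρ) : IsSpectralMeasure N ρ (sumSpectralMeasure N ρ) := by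
  have hf : IsFiniteMeasure (sumSpectralMeasure N ρ) :=
    ⟨by rw [sumSpectralMeasure_univ hN hρ]; simp⟩
  refine ⟨hf, fun g hg hb => ?_⟩
  obtain ⟨C, hC⟩ := hb
  rw [hρ.trace_mul]
  simp only [isBorelCalculus_borelCalculus N hN hg ⟨C, hC⟩ _]
  have hi : Integrable g (sumSpectralMeasure N ρ) :=
    Integrable.of_bound hg.aestronglyMeasurable C (ae_of_all _ hC)
  exact (hasSum_integral_measure hi).tsum_eq

theorem IsSpectralMeasure.unique {N ρ : H →L[ℂ] H} {m m' : Measure ℝ}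
    (h : IsSpectralMeasure N ρ m) (h' : IsSpectralMeasure N ρ m') : m = m' := by
  have := h.isFinite
  have := h'.isFinite
  ext s hs
  rw [← measureReal_eq_measureReal_iff]
  have hg : Measurable (s.indicator fun _ => (1 : ℂ)) := measurable_const.indicator hs
  have hb : ∃ C : ℝ, ∀ ν, ‖s.indicator (fun _ => (1 : ℂ)) ν‖ ≤ C :=
    ⟨1, fun ν => (norm_indicator_le_norm_self _ _).trans (by simp)⟩
  have e := (h.trace_eq _ hg hb).symm.trans (h'.trace_eq _ hg hb)
  simpa [integral_indicator_const _ hs] using e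

theorem spectralMeasure_eq_sum {N ρ : H →L[ℂ] H} (hN : IsSelfAdjoint N)
    (hρ : IsDensityMatrix ρ) : spectralMeasure N ρ = sumSpectralMeasure N ρ := by
  have hex : ∃ m, IsSpectralMeasure N ρ m := ⟨_, isSpectralMeasure_sum hN hρ⟩
  rw [spectralMeasure, dif_pos hex]
  exact hex.choose_spec.unique (isSpectralMeasure_sum hN hρ)

theorem isProbabilityMeasure_spectralMeasure {N ρ : H →L[ℂ] H} (hN : IsSelfAdjoint N)
    (hρ : IsDensityMatrix ρ) : IsProbabilityMeasure (spectralMeasure N ρ) :=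
  ⟨by rw [spectralMeasure_eq_sum hN hρ, sumSpectralMeasure_univ hN hρ]⟩

theorem spectralMeasure_ae_mem {N ρ : H →L[ℂ] H} (hN : IsSelfAdjoint N)
    (hρ : IsDensityMatrix ρ) : ∀ᵐ ν ∂(spectralMeasure N ρ), ν ∈ spectrum ℝ N := by
  rw [spectralMeasure_eq_sum hN hρ, sumSpectralMeasure]
  exact (Measure.ae_sum_iff' (spectrum.isClosed (𝕜 := ℝ) N).measurableSet).2 fun i => ae_mem_spectrum N _

end Trace

/-! ### Finite and infinite product measures -/

section FiniteProducts

variable {X : Type*} [MeasurableSpace X]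

theorem lintegral_pi_prod (μ : Measure X) [SigmaFinite μ] (k : ℕ) (f : Fin k → X → ℝ≥0∞)
    (hf : ∀ i, Measurable (f i)) :
    ∫⁻ x, ∏ i, f i (x i) ∂(Measure.pi fun _ : Fin k => μ) = ∏ i, ∫⁻ ξ, f i ξ ∂μ := by
  induction k with
  | zero => simp
  | succ k ih =>
    have hmp := (measurePreserving_piFinSuccAbove (fun _ : Fin (k + 1) => μ) 0).symm
    rw [← hmp.lintegral_comp_emb (MeasurableEquiv.measurableEmbedding _),
      lintegral_prod _ (by fun_prop), Fin.prod_univ_succ, ← ih _ (fun i => hf i.succ)]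
    simp only [MeasurableEquiv.piFinSuccAbove_symm_apply, Fin.prod_univ_succ, Fin.insertNthEquiv,
      Equiv.coe_fn_mk, Fin.insertNth_zero', Fin.cons_zero, Fin.cons_succ]
    rw [← lintegral_mul_const _ (hf 0)]
    refine lintegral_congr fun ξ => ?_
    rw [lintegral_const_mul _ (by fun_prop)]

theorem pi_withDensity_apply (μ : Measure X) [SigmaFinite μ] (k : ℕ) {f : X → ℝ≥0∞}
    (hf : Measurable f) [SigmaFinite (μ.withDensity f)] {E : Set (Fin k → X)}
    (hE : MeasurableSet E) :
    Measure.pi (fun _ : Fin k => μ.withDensity f) E =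
      ∫⁻ x in E, ∏ i, f (x i) ∂(Measure.pi fun _ : Fin k => μ) := by
  have h : Measure.pi (fun _ : Fin k => μ.withDensity f) =
      (Measure.pi fun _ : Fin k => μ).withDensity fun x => ∏ i, f (x i) := by
    refine (Measure.pi_eq fun s hs => ?_)
    rw [withDensity_apply _ (MeasurableSet.univ_pi hs),
      ← lintegral_indicator (MeasurableSet.univ_pi hs)]
    have e : ∀ x : Fin k → X, (Set.univ.pi s).indicator (fun x => ∏ i, f (x i)) x =
        ∏ i, (s i).indicator f (x i) := fun x => by
      by_cases hx : x ∈ Set.univ.pi s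
      · rw [Set.indicator_of_mem hx]
        exact Finset.prod_congr rfl fun i _ => (Set.indicator_of_mem (hx i trivial) f).symm
      · rw [Set.indicator_of_notMem hx]
        simp only [Set.mem_pi, Set.mem_univ, true_implies, not_forall] at hx
        obtain ⟨i, hi⟩ := hx
        exact (Finset.prod_eq_zero (Finset.mem_univ i) (Set.indicator_of_notMem hi f)).symm
    simp only [e]
    rw [lintegral_pi_prod μ k (fun i => (s i).indicator f) fun i => hf.indicator (hs i)]
    refine Finset.prod_congr rfl fun i _ => ?_
    rw [lintegral_indicator (hs i), withDensity_apply _ (hs i)]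
  rw [h, withDensity_apply _ hE]

/-- Cylinders form a generating π-system, and on a cylinder the product measure is a finite product
of measurable functions. This makes the mixture of product laws meaningful. -/
theorem measurable_infinitePi {α : Type*} [MeasurableSpace α] {Q : α → Measure X}
    [∀ a, IsProbabilityMeasure (Q a)] (hQ : Measurable Q) :
    Measurable fun a => Measure.infinitePi fun _ : ℕ => Q a := by
  refine Measurable.measure_of_isPiSystem_of_isProbabilityMeasure
    (generateFrom_squareCylinders (α := fun _ : ℕ => X)).symm
    (isPiSystem_squareCylinders (fun _ => MeasurableSpace.isPiSystem_measurableSet)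
      (fun _ => MeasurableSet.univ)) ?_
  rintro _ ⟨s, t, ht, rfl⟩
  have ht' : ∀ i, MeasurableSet (t i) := fun i => ht i trivial
  simp only [Measure.infinitePi_pi (fun _ : ℕ => Q _) (fun i _ => ht' i)]
  exact Finset.measurable_fun_prod _ fun i _ => (Measure.measurable_coe (ht' i)).comp hQ

theorem infinitePi_initial (Q : Measure X) [IsProbabilityMeasure Q] (k : ℕ)
    {E : Set (Fin k → X)} (hE : MeasurableSet E) :
    Measure.infinitePi (fun _ : ℕ => Q) {ω | (fun i : Fin k => ω i) ∈ E} =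
      Measure.pi (fun _ : Fin k => Q) E := by
  have hm : Measurable fun (ω : ℕ → X) (i : Fin k) => ω i := by fun_prop
  have h : (Measure.infinitePi (fun _ : ℕ => Q)).map (fun ω (i : Fin k) => ω i) =
      Measure.pi (fun _ : Fin k => Q) := by
    symm
    refine Measure.pi_eq fun s hs => ?_
    rw [Measure.map_apply hm (MeasurableSet.univ_pi hs)]
    let t : ℕ → Set X := fun n => if h : n < k then s ⟨n, h⟩ else Set.univ
    have e : (fun (ω : ℕ → X) (i : Fin k) => ω i) ⁻¹' Set.univ.pi s =
        (Finset.range k : Set ℕ).pi t := by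
      ext ω
      simp only [Set.mem_preimage, Set.mem_pi, Set.mem_univ, true_implies, Finset.coe_range,
        Set.mem_Iio, t]
      constructor
      · intro h n hn
        rw [dif_pos hn]
        exact h ⟨n, hn⟩
      · intro h i
        have := h i i.2
        rwa [dif_pos i.2] at this
    rw [e, Measure.infinitePi_pi _ (fun n hn => by
      simp only [Finset.mem_range] at hn
      simp only [t, dif_pos hn]
      exact hs _), Finset.prod_range]
    refine Finset.prod_congr rfl fun i _ => ?_
    simp only [t, dif_pos i.2]
  rw [← h, Measure.map_apply hm hE]
  rfl

end FiniteProducts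

/-! ### The outcome law as a mixture of product laws -/

section OutcomeLaw

variable {H : Type*} [NormedAddCommGroup H] [InnerProductSpace ℂ H] [CompleteSpace H]
  {X : Type*} [MeasurableSpace X]

/-- Any finite set of coordinates lies in an initial segment, so the prescribed laws fix every
finite marginal and hence the projective limit. -/
theorem IsOutcomeLaw.unique {μ : Measure X} {W : X → H →L[ℂ] H} {ρ : H →L[ℂ] H}
    {P P' : Measure (ℕ → X)} [IsFiniteMeasure P] (h : IsOutcomeLaw μ W ρ P)
    (h' : IsOutcomeLaw μ W ρ P') : P' = P := by
  refine IsProjectiveLimit.unique (P := fun I => P.map I.restrict) (fun I => ?_) (fun I => rfl)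
  obtain ⟨k, hk⟩ : ∃ k, I ⊆ Finset.range k := ⟨I.sup id + 1, fun i hi =>
    Finset.mem_range.2 (Nat.lt_succ_of_le (Finset.le_sup (f := id) hi))⟩
  ext E hE
  have hm : Measurable fun (x : Fin k → X) (i : I) =>
      x ⟨i, Finset.mem_range.1 (hk i.2)⟩ := by fun_prop
  rw [Measure.map_apply (by fun_prop) hE, Measure.map_apply (by fun_prop) hE]
  exact (h' k _ (hm hE)).trans (h k _ (hm hE)).symm

theorem measurable_density {V : X → ℝ → ℂ} (hV : Measurable (Function.uncurry V)) :
    Measurable fun p : X × ℝ => density V p.1 p.2 := by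
  have : (fun p : X × ℝ => density V p.1 p.2) = fun p => ‖Function.uncurry V p‖ ^ 2 := rfl
  rw [this]
  fun_prop

theorem IsJumpFamily.measurable_apply {μ : Measure X} {V : X → ℝ → ℂ} {S : Set ℝ}
    (hV : IsJumpFamily μ V S) (ξ : X) : Measurable (V ξ) :=
  hV.measurable.comp measurable_prodMk_left

/-- Each measurement reweights the spectral measure by its likelihood: the non-demolition property,
in the form of Bayes' rule before normalisation. -/
theorem vectorSpectralMeasure_jumpProd {μ : Measure X} {N : H →L[ℂ] H} (hN : IsSelfAdjoint N)
    {V : X → ℝ → ℂ} {S : Set ℝ} (hV : IsJumpFamily μ V S) (k : ℕ) (x : Fin k → X) (ψ : H) :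
    vectorSpectralMeasure N (jumpProd (fun ξ => borelCalculus N (V ξ)) k x ψ) =
      (vectorSpectralMeasure N ψ).withDensity fun ν =>
        ∏ i, ENNReal.ofReal (density V (x i) ν) := by
  have hd : ∀ ξ, Measurable (density V ξ) := fun ξ =>
    (measurable_density hV.measurable).comp measurable_prodMk_left
  induction k with
  | zero => simp [jumpProd]
  | succ k ih =>
    simp only [jumpProd, mul_apply_eq_comp]
    rw [vectorSpectralMeasure_borelCalculus N hN (hV.measurable_apply _) (hV.bounded _),
      ih (fun i => x i.castSucc), ← withDensity_mul₀]
    · congr 1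
      funext ν
      rw [Fin.prod_univ_castSucc]
      rfl
    · exact (Finset.measurable_fun_prod _ fun i _ => (hd _).ennreal_ofReal).aemeasurable
    · exact ((hd _).ennreal_ofReal).aemeasurable

theorem ofReal_trace_jumpProd {μ : Measure X} {N ρ : H →L[ℂ] H} (hN : IsSelfAdjoint N)
    (hρ : IsDensityMatrix ρ) {V : X → ℝ → ℂ} {S : Set ℝ} (hV : IsJumpFamily μ V S) (k : ℕ)
    (x : Fin k → X) :
    ENNReal.ofReal (trace (jumpProd (fun ξ => borelCalculus N (V ξ)) k x * ρ *
      ContinuousLinearMap.adjoint (jumpProd (fun ξ => borelCalculus N (V ξ)) k x))).re =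
      ∫⁻ ν, ∏ i, ENNReal.ofReal (density V (x i) ν) ∂(spectralMeasure N ρ) := by
  rw [hρ.ofReal_trace_conj, spectralMeasure_eq_sum hN hρ, sumSpectralMeasure,
    lintegral_sum_measure]
  refine tsum_congr fun i => ?_
  rw [← vectorSpectralMeasure_univ N hN, vectorSpectralMeasure_jumpProd hN hV,
    withDensity_apply _ MeasurableSet.univ, Measure.restrict_univ]

/-- The outcome law is the mixture of laws of independent outcomes. -/
theorem outcomeLaw_eq_bind {μ : Measure X} [SigmaFinite μ] {N ρ : H →L[ℂ] H}
    (hN : IsSelfAdjoint N) (hρ : IsDensityMatrix ρ) {V : X → ℝ → ℂ}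
    (hV : IsJumpFamily μ V (spectrum ℝ N)) {Q : ℝ → Measure X}
    [∀ ν, IsProbabilityMeasure (Q ν)] (hQm : Measurable Q)
    (hQ : ∀ ν ∈ spectrum ℝ N, Q ν = condLaw μ V ν) :
    outcomeLaw μ N V ρ =
      (spectralMeasure N ρ).bind fun ν => Measure.infinitePi fun _ : ℕ => Q ν := by
  have := isProbabilityMeasure_spectralMeasure hN hρ
  have hm := measurable_infinitePi hQm
  have hd := measurable_density hV.measurable
  have hlaw : IsOutcomeLaw μ (fun ξ => borelCalculus N (V ξ)) ρ
      ((spectralMeasure N ρ).bind fun ν => Measure.infinitePi fun _ : ℕ => Q ν) := by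
    intro k E hE
    have hE' : MeasurableSet {ω : ℕ → X | (fun i : Fin k => ω i) ∈ E} :=
      (show Measurable fun (ω : ℕ → X) (i : Fin k) => ω i by fun_prop) hE
    rw [Measure.bind_apply hE' hm.aemeasurable]
    simp only [infinitePi_initial _ k hE, ofReal_trace_jumpProd hN hρ hV]
    -- Tonelli: integrating over outcomes first leaves, for each `ν`, a product measure with density
    -- `∏ f(ξᵢ|ν)`.
    rw [lintegral_lintegral_swap]
    · refine lintegral_congr_ae ?_
      filter_upwards [spectralMeasure_ae_mem hN hρ] with ν hν
      have hp : IsProbabilityMeasure (condLaw μ V ν) := hQ ν hν ▸ inferInstance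
      rw [hQ ν hν]
      exact pi_withDensity_apply μ k (f := fun ξ => ENNReal.ofReal (density V ξ ν))
        (hd.comp measurable_prodMk_right).ennreal_ofReal hE
    · refine Measurable.aemeasurable ?_
      refine Finset.measurable_fun_prod _ fun i _ => Measurable.ennreal_ofReal ?_
      have hi : Measurable fun p : (Fin k → X) × ℝ => (p.1 i, p.2) := by fun_prop
      exact hd.comp hi
  have : IsProbabilityMeasure
      ((spectralMeasure N ρ).bind fun ν => Measure.infinitePi fun _ : ℕ => Q ν) :=
    isProbabilityMeasure_bind hm.aemeasurable (ae_of_all _ fun ν => inferInstance)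
  have hex : ∃ P, IsOutcomeLaw μ (fun ξ => borelCalculus N (V ξ)) ρ P := ⟨_, hlaw⟩
  rw [outcomeLaw, dif_pos hex]
  exact hlaw.unique hex.choose_spec

end OutcomeLaw

/-! ### Laws of large numbers for independent outcomes -/

section LawOfLargeNumbers

variable {X : Type*} [MeasurableSpace X]

theorem iIndepFun_comp_eval (Q : Measure X) [IsProbabilityMeasure Q] {h : X → ℝ}
    (hm : Measurable h) :
    iIndepFun (fun (i : ℕ) (ω : ℕ → X) => h (ω i)) (Measure.infinitePi fun _ : ℕ => Q) :=
  iIndepFun_infinitePi (X := fun _ => h) fun _ => hm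

theorem map_comp_eval (Q : Measure X) [IsProbabilityMeasure Q] {h : X → ℝ}
    (hm : Measurable h) (i : ℕ) :
    (Measure.infinitePi fun _ : ℕ => Q).map (fun ω => h (ω i)) = Q.map h := by
  have := Measure.infinitePi_map_eval (fun _ : ℕ => Q) i
  conv_rhs => rw [← this]
  rw [Measure.map_map hm (measurable_pi_apply i)]
  rfl

theorem identDistrib_comp_eval (Q : Measure X) [IsProbabilityMeasure Q] {h : X → ℝ}
    (hm : Measurable h) (i : ℕ) :
    IdentDistrib (fun ω : ℕ → X => h (ω i)) h (Measure.infinitePi fun _ : ℕ => Q) Q :=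
  ⟨(hm.comp (measurable_pi_apply i)).aemeasurable, hm.aemeasurable, map_comp_eval Q hm i⟩

theorem tendsto_average_ae (Q : Measure X) [IsProbabilityMeasure Q] {h : X → ℝ}
    (hm : Measurable h) (hi : Integrable h Q) :
    ∀ᵐ ω ∂(Measure.infinitePi fun _ : ℕ => Q),
      Tendsto (fun k : ℕ => (1 / (k : ℝ)) * ∑ j ∈ Finset.range k, h (ω j)) atTop
        (𝓝 (∫ ξ, h ξ ∂Q)) := by
  have h0 := identDistrib_comp_eval Q hm
  have := strong_law_ae_real (fun (i : ℕ) (ω : ℕ → X) => h (ω i))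
    ((h0 0).integrable_iff.2 hi)
    (fun i j hij => (iIndepFun_comp_eval Q hm).indepFun hij)
    (fun i => (h0 i).trans (h0 0).symm)
  rw [(h0 0).integral_eq] at this
  filter_upwards [this] with ω hω
  refine hω.congr fun k => ?_
  rw [div_eq_inv_mul, one_div]

/-- A local uniform law of large numbers for families which depend continuously on a parameter
and are dominated by an integrable function. -/
theorem exists_delta_average_near (Q : Measure X) [IsProbabilityMeasure Q] {S : Set ℝ}
    {h : X → ℝ → ℝ} (hm : ∀ ν ∈ S, Measurable fun ξ => h ξ ν) (hc : ∀ ξ, ContinuousOn (h ξ) S)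
    {g : X → ℝ} (hg : Integrable g Q) (hb : ∀ ξ, ∀ ν ∈ S, |h ξ ν| ≤ g ξ) {ν : ℝ} (hν : ν ∈ S)
    {ε : ℝ} (hε : 0 < ε) :
    ∃ δ > 0, ∀ᵐ ω ∂(Measure.infinitePi fun _ : ℕ => Q), ∀ᶠ k : ℕ in atTop, ∀ ν' ∈ S,
      |ν' - ν| < δ →
        |(1 / (k : ℝ)) * ∑ j ∈ Finset.range k, h (ω j) ν' - ∫ ξ, h ξ ν ∂Q| < ε := by
  -- Taking the oscillation over a countable dense subset of `S` keeps the supremum measurable;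
  -- continuity extends the bound to all of `S`.
  obtain ⟨D, hDS, hDc, hD⟩ :=
    (TopologicalSpace.IsSeparable.of_separableSpace S).exists_countable_dense_subset
  let r : ℕ → ℝ := fun m => 1 / ((m : ℝ) + 1)
  have hr : ∀ m, 0 < r m := fun m => Nat.one_div_pos_of_nat
  let I : ℕ → Set ℝ := fun m => {d ∈ D | |d - ν| < r m}
  have hIc : ∀ m, Countable (I m) := fun m => (hDc.mono fun d hd => hd.1).to_subtype
  let osc : ℕ → X → ℝ := fun m ξ => ⨆ d : I m, |h ξ d - h ξ ν|
  have hterm : ∀ ξ, ∀ d ∈ S, |h ξ d - h ξ ν| ≤ 2 * g ξ := fun ξ d hd => by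
    have := abs_sub (h ξ d) (h ξ ν)
    linarith [hb ξ d hd, hb ξ ν hν]
  have hg0 : ∀ ξ, 0 ≤ g ξ := fun ξ => (abs_nonneg _).trans (hb ξ ν hν)
  have hosc0 : ∀ m ξ, 0 ≤ osc m ξ := fun m ξ => Real.iSup_nonneg fun d => abs_nonneg _
  have hoscg : ∀ m ξ, osc m ξ ≤ 2 * g ξ := fun m ξ =>
    Real.iSup_le (fun d => hterm ξ d (hDS d.2.1)) (by linarith [hg0 ξ])
  have hbdd : ∀ m ξ, BddAbove (Set.range fun d : I m => |h ξ d - h ξ ν|) := fun m ξ =>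
    ⟨2 * g ξ, by rintro _ ⟨d, rfl⟩; exact hterm ξ d (hDS d.2.1)⟩
  have hoscm : ∀ m, Measurable (osc m) := fun m => by
    have := hIc m
    exact Measurable.iSup fun d => ((hm d (hDS d.2.1)).sub (hm ν hν)).abs
  have hle : ∀ m ξ, ∀ ν' ∈ S, |ν' - ν| < r m → |h ξ ν' - h ξ ν| ≤ osc m ξ := by
    intro m ξ ν' hν' hd
    have hopen : IsOpen {d : ℝ | |d - ν| < r m} := isOpen_lt (by fun_prop) continuous_const
    have hcl : ν' ∈ closure ({d : ℝ | |d - ν| < r m} ∩ D) := hopen.inter_closure ⟨hd, hD hν'⟩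
    obtain ⟨u, hu, hut⟩ := mem_closure_iff_seq_limit.1 hcl
    have ht : Tendsto (fun n => h ξ (u n)) atTop (𝓝 (h ξ ν')) :=
      (hc ξ ν' hν').tendsto.comp (tendsto_nhdsWithin_iff.2
        ⟨hut, Eventually.of_forall fun n => hDS (hu n).2⟩)
    exact le_of_tendsto (ht.sub_const _).abs
      (Eventually.of_forall fun n => le_ciSup (hbdd m ξ) ⟨u n, (hu n).2, (hu n).1⟩)
  have hlim : ∀ ξ, Tendsto (fun m => osc m ξ) atTop (𝓝 0) := by
    intro ξ
    rw [Metric.tendsto_atTop]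
    intro η hη
    obtain ⟨δ, hδ, hδ'⟩ := Metric.continuousWithinAt_iff.1 (hc ξ ν hν) (η / 2) (half_pos hη)
    obtain ⟨M, hM⟩ := exists_nat_one_div_lt hδ
    refine ⟨M, fun m hm' => ?_⟩
    rw [Real.dist_0_eq_abs, abs_of_nonneg (hosc0 m ξ)]
    refine (Real.iSup_le (fun d => ?_) (half_pos hη).le).trans_lt (half_lt_self hη)
    have hrm : r m ≤ 1 / ((M : ℝ) + 1) := Nat.one_div_le_one_div hm'
    exact (hδ' (hDS d.2.1) (d.2.2.trans_le (hrm.trans hM.le))).le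
  have hint : Tendsto (fun m => ∫ ξ, osc m ξ ∂Q) atTop (𝓝 0) := by
    have := tendsto_integral_of_dominated_convergence (μ := Q) (F := osc) (f := fun _ => (0 : ℝ))
      (fun ξ => 2 * g ξ) (fun m => (hoscm m).aestronglyMeasurable) (hg.const_mul 2)
      (fun m => ae_of_all _ fun ξ => by
        rw [Real.norm_of_nonneg (hosc0 m ξ)]; exact hoscg m ξ) (ae_of_all _ hlim)
    simpa using this
  -- The radius makes the mean oscillation less than `ε / 2`; the law of large numbers for the
  -- oscillation and for `h · ν` gives the two halves of `ε`.
  obtain ⟨m, hmlt⟩ := (hint.eventually_lt_const (half_pos hε)).exists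
  have hoi : Integrable (osc m) Q := (hg.const_mul 2).mono' (hoscm m).aestronglyMeasurable
    (ae_of_all _ fun ξ => by rw [Real.norm_of_nonneg (hosc0 m ξ)]; exact hoscg m ξ)
  have hhi : Integrable (fun ξ => h ξ ν) Q := hg.mono' (hm ν hν).aestronglyMeasurable
    (ae_of_all _ fun ξ => hb ξ ν hν)
  refine ⟨r m, hr m, ?_⟩
  filter_upwards [tendsto_average_ae Q (hoscm m) hoi, tendsto_average_ae Q (hm ν hν) hhi]
    with ω h1 h2
  filter_upwards [h1.eventually_lt_const hmlt, Metric.tendsto_nhds.1 h2 _ (half_pos hε)]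
    with k hk1 hk2 ν' hν' hd
  rw [Real.dist_eq] at hk2
  have h3 : |(1 / (k : ℝ)) * ∑ j ∈ Finset.range k, h (ω j) ν' -
      (1 / (k : ℝ)) * ∑ j ∈ Finset.range k, h (ω j) ν| ≤
      (1 / (k : ℝ)) * ∑ j ∈ Finset.range k, osc m (ω j) := by
    rw [← mul_sub, ← Finset.sum_sub_distrib, abs_mul, abs_of_nonneg (by positivity)]
    refine mul_le_mul_of_nonneg_left ?_ (by positivity)
    exact (Finset.abs_sum_le_sum_abs _ _).trans
      (Finset.sum_le_sum fun j _ => hle m (ω j) ν' hν' hd)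
  calc _ ≤ _ + _ := abs_sub_le _ ((1 / (k : ℝ)) * ∑ j ∈ Finset.range k, h (ω j) ν) _
    _ < ε / 2 + ε / 2 := add_lt_add_of_le_of_lt (h3.trans hk1.le) hk2
    _ = ε := add_halves ε

end LawOfLargeNumbers

/-! ### Score, curvature and the information identity -/

section Derivatives

variable {X : Type*} [MeasurableSpace X]

/-- The derivative is the pointwise limit of the jointly measurable difference quotients with step
`1 / (n + 1)`. -/
theorem measurable_deriv_param {F : X → ℝ → ℝ} (hF : Measurable (Function.uncurry F))
    (hd : ∀ ξ, Differentiable ℝ (F ξ)) :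
    Measurable (Function.uncurry fun ξ ν => deriv (F ξ) ν) := by
  refine measurable_of_tendsto_metrizable (f := fun (n : ℕ) (p : X × ℝ) =>
    ((1 / ((n : ℝ) + 1)))⁻¹ • (F p.1 (p.2 + 1 / ((n : ℝ) + 1)) - F p.1 p.2)) (fun n => ?_) ?_
  · have h1 : Measurable fun p : X × ℝ => F p.1 (p.2 + 1 / ((n : ℝ) + 1)) :=
      hF.comp (g := Function.uncurry F)
        (show Measurable fun p : X × ℝ => (p.1, p.2 + 1 / ((n : ℝ) + 1)) by fun_prop)
    exact (h1.sub hF).const_smul ((1 / ((n : ℝ) + 1))⁻¹)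
  · refine tendsto_pi_nhds.2 fun p => ?_
    have h := hasDerivAt_iff_tendsto_slope_zero.1 (hd p.1 p.2).hasDerivAt
    refine h.comp (tendsto_nhdsWithin_iff.2 ⟨tendsto_one_div_add_atTop_nhds_zero_nat, ?_⟩)
    exact Eventually.of_forall fun n => by
      simp only [Set.mem_compl_iff, Set.mem_singleton_iff]
      positivity

variable {μ : Measure X} {V : X → ℝ → ℂ} {S : Set ℝ}

theorem CLTAssumption.differentiable_density (h : CLTAssumption μ V S) (ξ : X) :
    Differentiable ℝ (density V ξ) := (h.contDiff ξ).differentiable (by norm_num)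

theorem CLTAssumption.differentiable_deriv_density (h : CLTAssumption μ V S) (ξ : X) :
    Differentiable ℝ (deriv (density V ξ)) :=
  (contDiff_succ_iff_deriv.1 (show ContDiff ℝ (1 + 1) (density V ξ) from
    (by simpa [one_add_one_eq_two] using h.contDiff ξ))).2.2.differentiable (by norm_num)

theorem CLTAssumption.eventually_pos (h : CLTAssumption μ V S) (ξ : X) {ν : ℝ} (hν : ν ∈ S) :
    ∀ᶠ ν' in 𝓝 ν, 0 < density V ξ ν' :=
  (h.differentiable_density ξ).continuous.continuousAt.eventually (lt_mem_nhds (h.pos ν hν ξ))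

theorem CLTAssumption.hasDerivAt_logLik (h : CLTAssumption μ V S) (ξ : X) {ν : ℝ}
    (hν : 0 < density V ξ ν) :
    HasDerivAt (logLik V ξ) (deriv (density V ξ) ν / density V ξ ν) ν :=
  (h.differentiable_density ξ ν).hasDerivAt.log hν.ne'

theorem CLTAssumption.deriv_logLik (h : CLTAssumption μ V S) (ξ : X) {ν : ℝ} (hν : ν ∈ S) :
    deriv (logLik V ξ) ν = deriv (density V ξ) ν / density V ξ ν :=
  (h.hasDerivAt_logLik ξ (h.pos ν hν ξ)).deriv

theorem CLTAssumption.hasDerivAt_deriv_logLik (h : CLTAssumption μ V S) (ξ : X) {ν : ℝ}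
    (hν : ν ∈ S) :
    HasDerivAt (deriv (logLik V ξ)) (iteratedDeriv 2 (density V ξ) ν / density V ξ ν -
      (deriv (logLik V ξ) ν) ^ 2) ν := by
  -- Positivity is assumed only on `S`, but by continuity it persists in a full neighbourhood, as a
  -- two-sided derivative requires.
  have he : deriv (logLik V ξ) =ᶠ[𝓝 ν] fun ν' => deriv (density V ξ) ν' / density V ξ ν' := by
    filter_upwards [h.eventually_pos ξ hν] with ν' h'
    exact (h.hasDerivAt_logLik ξ h').deriv
  have hp := h.pos ν hν ξ
  have h1 := (h.differentiable_deriv_density ξ ν).hasDerivAt.div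
    (h.differentiable_density ξ ν).hasDerivAt hp.ne'
  refine (h1.congr_of_eventuallyEq he).congr_deriv ?_
  rw [h.deriv_logLik ξ hν, iteratedDeriv_succ, iteratedDeriv_one]
  field_simp

theorem CLTAssumption.iteratedDeriv_two_logLik (h : CLTAssumption μ V S) (ξ : X) {ν : ℝ}
    (hν : ν ∈ S) :
    iteratedDeriv 2 (logLik V ξ) ν = iteratedDeriv 2 (density V ξ) ν / density V ξ ν -
      (deriv (logLik V ξ) ν) ^ 2 := by
  rw [iteratedDeriv_succ, iteratedDeriv_one]
  exact (h.hasDerivAt_deriv_logLik ξ hν).deriv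

theorem CLTAssumption.continuousOn_logLik (h : CLTAssumption μ V S) (ξ : X) :
    ContinuousOn (logLik V ξ) S := fun ν hν =>
  (h.hasDerivAt_logLik ξ (h.pos ν hν ξ)).continuousAt.continuousWithinAt

theorem CLTAssumption.continuousOn_iteratedDeriv_two (h : CLTAssumption μ V S) (ξ : X) :
    ContinuousOn (iteratedDeriv 2 (logLik V ξ)) S := by
  refine ContinuousOn.congr (f := fun ν => iteratedDeriv 2 (density V ξ) ν / density V ξ ν -
      (deriv (logLik V ξ) ν) ^ 2) ?_ fun ν hν => h.iteratedDeriv_two_logLik ξ hν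
  have h2 : Continuous (iteratedDeriv 2 (density V ξ)) :=
    (h.contDiff ξ).continuous_iteratedDeriv 2 (by norm_num)
  have hd := (h.differentiable_density ξ).continuous
  refine (h2.continuousOn.div hd.continuousOn fun ν hν => (h.pos ν hν ξ).ne').sub
    (ContinuousOn.pow (fun ν hν => ?_) 2)
  exact (h.hasDerivAt_deriv_logLik ξ hν).continuousAt.continuousWithinAt

theorem CLTAssumption.measurable_deriv_density (h : CLTAssumption μ V S)
    (hV : IsJumpFamily μ V S) :
    Measurable (Function.uncurry fun ξ ν => deriv (density V ξ) ν) :=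
  measurable_deriv_param (F := density V) (measurable_density hV.measurable)
    h.differentiable_density

theorem CLTAssumption.measurable_iteratedDeriv_density (h : CLTAssumption μ V S)
    (hV : IsJumpFamily μ V S) (ν : ℝ) :
    Measurable fun ξ => iteratedDeriv 2 (density V ξ) ν := by
  have h2 : Measurable (Function.uncurry fun ξ ν => deriv (deriv (density V ξ)) ν) :=
    measurable_deriv_param (h.measurable_deriv_density hV) h.differentiable_deriv_density
  have e : (fun ξ => iteratedDeriv 2 (density V ξ) ν) =
      Function.uncurry (fun ξ ν => deriv (deriv (density V ξ)) ν) ∘ fun ξ => (ξ, ν) := by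
    funext ξ
    rw [iteratedDeriv_succ, iteratedDeriv_one, Function.comp_apply, Function.uncurry_apply_pair]
  rw [e]
  exact h2.comp measurable_prodMk_right

theorem IsJumpFamily.measurable_density_left (hV : IsJumpFamily μ V S) (ν : ℝ) :
    Measurable fun ξ => density V ξ ν :=
  (measurable_density hV.measurable).comp measurable_prodMk_right

theorem IsJumpFamily.measurable_logLik_left (hV : IsJumpFamily μ V S) (ν : ℝ) :
    Measurable fun ξ => logLik V ξ ν :=
  Real.measurable_log.comp (hV.measurable_density_left ν)

theorem CLTAssumption.measurable_score (h : CLTAssumption μ V S)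
    (hV : IsJumpFamily μ V S) {ν : ℝ} (hν : ν ∈ S) :
    Measurable fun ξ => deriv (logLik V ξ) ν := by
  simp only [h.deriv_logLik _ hν]
  exact ((h.measurable_deriv_density hV).comp measurable_prodMk_right).div
    (hV.measurable_density_left ν)

theorem CLTAssumption.measurable_iteratedDeriv_logLik (h : CLTAssumption μ V S)
    (hV : IsJumpFamily μ V S) {ν : ℝ} (hν : ν ∈ S) :
    Measurable fun ξ => iteratedDeriv 2 (logLik V ξ) ν := by
  simp only [h.iteratedDeriv_two_logLik _ hν]
  exact ((h.measurable_iteratedDeriv_density hV ν).div (hV.measurable_density_left ν)).sub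
    ((h.measurable_score hV hν).pow_const 2)

theorem integral_condLaw (hV : IsJumpFamily μ V S) (ν : ℝ) (φ : X → ℝ) :
    ∫ ξ, φ ξ ∂(condLaw μ V ν) = ∫ ξ, density V ξ ν * φ ξ ∂μ := by
  rw [condLaw, integral_withDensity_eq_integral_toReal_smul
    (hV.measurable_density_left ν).ennreal_ofReal (ae_of_all _ fun x => by simp)]
  refine integral_congr_ae (ae_of_all _ fun ξ => ?_)
  dsimp only
  rw [ENNReal.toReal_ofReal (by unfold density; positivity), smul_eq_mul]

theorem integrable_condLaw_iff (hV : IsJumpFamily μ V S) (ν : ℝ) (φ : X → ℝ) :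
    Integrable φ (condLaw μ V ν) ↔ Integrable (fun ξ => density V ξ ν * φ ξ) μ := by
  rw [condLaw, integrable_withDensity_iff_integrable_smul'
    (hV.measurable_density_left ν).ennreal_ofReal (ae_of_all _ fun x => by simp)]
  refine integrable_congr (ae_of_all _ fun ξ => ?_)
  dsimp only
  rw [ENNReal.toReal_ofReal (by unfold density; positivity), smul_eq_mul]

theorem isProbabilityMeasure_condLaw (hV : IsJumpFamily μ V S) (hL : LLNAssumption μ V S)
    {ν : ℝ} (hν : ν ∈ S) : IsProbabilityMeasure (condLaw μ V ν) := by
  constructor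
  rw [condLaw, withDensity_apply _ MeasurableSet.univ, Measure.restrict_univ,
    ← ofReal_integral_eq_lintegral_ofReal (hL.integrable ν hν)
      (ae_of_all _ fun ξ => by unfold density; positivity), hV.normalised ν hν, ENNReal.ofReal_one]

theorem CLTAssumption.integral_score (h : CLTAssumption μ V S) (hV : IsJumpFamily μ V S) {ν : ℝ}
    (hν : ν ∈ S) : ∫ ξ, deriv (logLik V ξ) ν ∂(condLaw μ V ν) = 0 := by
  rw [integral_condLaw hV, ← (h.deriv_integral ν hν 1 (by simp)).2]
  refine integral_congr_ae (ae_of_all _ fun ξ => ?_)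
  have := (h.pos ν hν ξ).ne'
  simp only [h.deriv_logLik ξ hν, iteratedDeriv_one]
  field_simp

/-- The information identity. -/
theorem CLTAssumption.fisher_eq (h : CLTAssumption μ V S) (hV : IsJumpFamily μ V S) {ν : ℝ}
    (hν : ν ∈ S) :
    ∫ ξ, iteratedDeriv 2 (logLik V ξ) ν ∂(condLaw μ V ν) = -fisher μ V ν := by
  have e : ∀ ξ, density V ξ ν * (iteratedDeriv 2 (density V ξ) ν / density V ξ ν) =
      iteratedDeriv 2 (density V ξ) ν := fun ξ => by
    have := (h.pos ν hν ξ).ne'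
    field_simp
  obtain ⟨hi, h0⟩ := h.deriv_integral ν hν 2 (by simp)
  have h1 : Integrable (fun ξ => iteratedDeriv 2 (density V ξ) ν / density V ξ ν)
      (condLaw μ V ν) := by
    rw [integrable_condLaw_iff hV]
    simpa only [e] using hi
  simp only [h.iteratedDeriv_two_logLik _ hν]
  rw [integral_sub h1 (h.score_memLp ν hν).integrable_sq, integral_condLaw hV]
  simp only [e]
  rw [h0, zero_sub, fisher]

theorem CLTAssumption.fisher_pos (h : CLTAssumption μ V S) (hV : IsJumpFamily μ V S) {ν : ℝ}
    (hν : ν ∈ S) : 0 < fisher μ V ν := by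
  have := h.info_pos ν hν
  rwa [integral_neg, h.fisher_eq hV hν, neg_neg] at this

end Derivatives

/-! ### Gibbs' inequality and strong consistency -/

section Consistency

variable {X : Type*} [MeasurableSpace X] {μ : Measure X} {V : X → ℝ → ℂ} {S : Set ℝ}

/-- Compactness bounds the family, so the real supremum is genuine and not the default value `0`. -/
theorem CLTAssumption.abs_logLik_le (h : CLTAssumption μ V S) (hS : IsCompact S) (ξ : X) {ν : ℝ}
    (hν : ν ∈ S) : |logLik V ξ ν| ≤ ⨆ ν' : S, |logLik V ξ ν'| := by
  obtain ⟨C, hC⟩ := hS.exists_bound_of_continuousOn (h.continuousOn_logLik ξ)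
  refine le_ciSup (f := fun ν' : S => |logLik V ξ ν'|) ⟨C, ?_⟩ ⟨ν, hν⟩
  rintro _ ⟨d, rfl⟩
  exact hC d d.2

theorem integrable_logLik (hV : IsJumpFamily μ V S) (hL : LLNAssumption μ V S)
    (hC : CLTAssumption μ V S) (hS : IsCompact S) {ν ν' : ℝ} (hν : ν ∈ S) (hν' : ν' ∈ S) :
    Integrable (fun ξ => logLik V ξ ν') (condLaw μ V ν) :=
  (hL.dominated ν hν).mono' (hV.measurable_logLik_left ν').aestronglyMeasurable
    (ae_of_all _ fun ξ => hC.abs_logLik_le hS ξ hν')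

/-- Gibbs' inequality: the expected log-likelihood is maximal only at the true parameter. -/
theorem integral_logLik_lt (hV : IsJumpFamily μ V S) (hL : LLNAssumption μ V S)
    (hC : CLTAssumption μ V S) (hS : IsCompact S) {ν ν' : ℝ} (hν : ν ∈ S) (hν' : ν' ∈ S)
    (hne : ν' ≠ ν) :
    ∫ ξ, logLik V ξ ν' ∂(condLaw μ V ν) < ∫ ξ, logLik V ξ ν ∂(condLaw μ V ν) := by
  have := isProbabilityMeasure_condLaw hV hL hν
  have e : ∀ ξ, density V ξ ν * (density V ξ ν' / density V ξ ν) = density V ξ ν' := fun ξ => by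
    have := (hC.pos ν hν ξ).ne'
    field_simp
  have hi1 : Integrable (fun ξ => density V ξ ν' / density V ξ ν) (condLaw μ V ν) := by
    rw [integrable_condLaw_iff hV]
    simpa only [e] using hL.integrable ν' hν'
  have hint : ∫ ξ, density V ξ ν' / density V ξ ν ∂(condLaw μ V ν) = 1 := by
    rw [integral_condLaw hV]
    simpa only [e] using hV.normalised ν' hν'
  have hi2 := integrable_logLik hV hL hC hS hν hν'
  have hi3 := integrable_logLik hV hL hC hS hν hν
  have hlog : ∀ ξ, Real.log (density V ξ ν' / density V ξ ν) = logLik V ξ ν' - logLik V ξ ν :=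
    fun ξ => Real.log_div (hC.pos ν' hν' ξ).ne' (hC.pos ν hν ξ).ne'
  -- This is `x - 1 - log x` at the likelihood ratio `x`: nonnegative, zero only at `x = 1`, with
  -- integral the gap to be shown positive.
  let d : X → ℝ := fun ξ => density V ξ ν' / density V ξ ν - 1 - (logLik V ξ ν' - logLik V ξ ν)
  have hpos : ∀ ξ, 0 < density V ξ ν' / density V ξ ν := fun ξ =>
    div_pos (hC.pos ν' hν' ξ) (hC.pos ν hν ξ)
  have hd0 : ∀ ξ, 0 ≤ d ξ := fun ξ => by
    have := Real.log_le_sub_one_of_pos (hpos ξ)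
    rw [hlog] at this
    exact sub_nonneg.2 this
  have hdi : Integrable d (condLaw μ V ν) := (hi1.sub (integrable_const 1)).sub (hi2.sub hi3)
  have hdint : ∫ ξ, d ξ ∂(condLaw μ V ν) =
      ∫ ξ, logLik V ξ ν ∂(condLaw μ V ν) - ∫ ξ, logLik V ξ ν' ∂(condLaw μ V ν) := by
    have h1 : Integrable (fun ξ => density V ξ ν' / density V ξ ν - 1) (condLaw μ V ν) :=
      hi1.sub (integrable_const 1)
    have h2 : Integrable (fun ξ => logLik V ξ ν' - logLik V ξ ν) (condLaw μ V ν) := hi2.sub hi3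
    simp only [d]
    rw [integral_sub h1 h2, integral_sub hi1 (integrable_const 1), integral_sub hi2 hi3, hint]
    simp
  have hdpos : 0 < ∫ ξ, d ξ ∂(condLaw μ V ν) := by
    refine lt_of_le_of_ne (integral_nonneg hd0) fun h0 => ?_
    have hz := (integral_eq_zero_iff_of_nonneg hd0 hdi).1 h0.symm
    rw [Filter.EventuallyEq, condLaw,
      ae_withDensity_iff (hV.measurable_density_left ν).ennreal_ofReal] at hz
    refine hL.identifiable ν' hν' ν hν hne ?_
    -- Positivity of the density turns `μ_ν`-almost everywhere into `μ`-almost everywhere, as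
    -- identifiability requires.
    filter_upwards [hz] with ξ hξ
    have h1 := hξ (by simpa using hC.pos ν hν ξ)
    by_contra hcon
    have h2 := Real.log_lt_sub_one_of_pos (hpos ξ) (fun h => hcon (by
      rwa [div_eq_one_iff_eq (hC.pos ν hν ξ).ne'] at h))
    rw [hlog] at h2
    simp only [d, Pi.zero_apply] at h1
    linarith
  linarith

theorem exists_delta_logLikAvg_lt (hV : IsJumpFamily μ V S) (hL : LLNAssumption μ V S)
    (hC : CLTAssumption μ V S) (hS : IsCompact S) {ν ν' : ℝ} (hν : ν ∈ S) (hν' : ν' ∈ S)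
    (hne : ν' ≠ ν) [IsProbabilityMeasure (condLaw μ V ν)] :
    ∃ δ > 0, ∀ᵐ ω ∂(Measure.infinitePi fun _ : ℕ => condLaw μ V ν), ∀ᶠ k : ℕ in atTop,
      ∀ a ∈ S, |a - ν'| < δ → logLikAvg V k ω a < logLikAvg V k ω ν := by
  have hlt := integral_logLik_lt hV hL hC hS hν hν' hne
  set c := ∫ ξ, logLik V ξ ν' ∂(condLaw μ V ν)
  set c0 := ∫ ξ, logLik V ξ ν ∂(condLaw μ V ν) with hc0
  -- With `ε` half the Gibbs gap, the midpoint `(c + c0) / 2` separates the two empirical averages.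
  obtain ⟨δ, hδ, hae⟩ := exists_delta_average_near (condLaw μ V ν) (S := S) (h := logLik V)
    (fun a _ => hV.measurable_logLik_left a) hC.continuousOn_logLik (hL.dominated ν hν)
    (fun ξ a ha => hC.abs_logLik_le hS ξ ha) hν' (ε := (c0 - c) / 2) (by linarith)
  refine ⟨δ, hδ, ?_⟩
  filter_upwards [hae, tendsto_average_ae (condLaw μ V ν) (hV.measurable_logLik_left ν)
    (integrable_logLik hV hL hC hS hν hν)] with ω h1 h2
  filter_upwards [h1, h2.eventually_const_lt (u := (c + c0) / 2) (by rw [← hc0]; linarith)]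
    with k hk1 hk2 a ha had
  have := (abs_lt.1 (hk1 a ha had)).2
  simp only [logLikAvg]
  linarith

/-- Strong consistency of the maximum likelihood estimator. -/
theorem tendsto_mle_ae (hV : IsJumpFamily μ V S) (hL : LLNAssumption μ V S)
    (hC : CLTAssumption μ V S) (hS : IsCompact S) {est : ℕ → (ℕ → X) → ℝ} (hE : IsMLE V S est)
    {ν : ℝ} (hν : ν ∈ S) [IsProbabilityMeasure (condLaw μ V ν)] :
    ∀ᵐ ω ∂(Measure.infinitePi fun _ : ℕ => condLaw μ V ν),
      Tendsto (fun k => est k ω) atTop (𝓝 ν) := by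
  have key : ∀ n : ℕ, ∀ᵐ ω ∂(Measure.infinitePi fun _ : ℕ => condLaw μ V ν), ∀ᶠ k : ℕ in atTop,
      |est k ω - ν| < 1 / ((n : ℝ) + 1) := by
    intro n
    have hK : IsCompact (S ∩ {a | 1 / ((n : ℝ) + 1) ≤ |a - ν|}) :=
      hS.inter_right (isClosed_le continuous_const (by fun_prop))
    have hmain : ∀ᵐ ω ∂(Measure.infinitePi fun _ : ℕ => condLaw μ V ν), ∀ᶠ k : ℕ in atTop,
        ∀ a ∈ S ∩ {a | 1 / ((n : ℝ) + 1) ≤ |a - ν|}, a ∈ S →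
          logLikAvg V k ω a < logLikAvg V k ω ν := by
      -- Compactness induction replaces a finite subcover. The clause `a ∈ S` in the predicate is
      -- there because the balls may leave `S`.
      refine hK.induction_on (p := fun s =>
        ∀ᵐ ω ∂(Measure.infinitePi fun _ : ℕ => condLaw μ V ν), ∀ᶠ k : ℕ in atTop,
          ∀ a ∈ s, a ∈ S → logLikAvg V k ω a < logLikAvg V k ω ν) (by simp) ?_ ?_ ?_
      · intro s t hst ht
        filter_upwards [ht] with ω hω
        filter_upwards [hω] with k hk a ha
        exact hk a (hst ha)
      · intro s t hs ht
        filter_upwards [hs, ht] with ω h1 h2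
        filter_upwards [h1, h2] with k hk1 hk2 a ha
        exact ha.elim (hk1 a) (hk2 a)
      · intro a ha
        have hane : a ≠ ν := fun h => by
          have : 1 / ((n : ℝ) + 1) ≤ |a - ν| := ha.2
          rw [h, sub_self, abs_zero] at this
          exact absurd this (not_le.2 Nat.one_div_pos_of_nat)
        obtain ⟨δ, hδ, hae⟩ := exists_delta_logLikAvg_lt hV hL hC hS hν ha.1 hane
        refine ⟨Metric.ball a δ, mem_nhdsWithin_of_mem_nhds (Metric.ball_mem_nhds a hδ), ?_⟩
        filter_upwards [hae] with ω hω
        filter_upwards [hω] with k hk b hb hbS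
        exact hk b hbS hb
    filter_upwards [hmain] with ω hω
    filter_upwards [hω] with k hk
    by_contra hcon
    have := hk (est k ω) ⟨hE.mem k ω, not_lt.1 hcon⟩ (hE.mem k ω)
    exact absurd (hE.isMax k ω ν hν) (not_le.2 this)
  filter_upwards [ae_all_iff.2 key] with ω hω
  rw [Metric.tendsto_nhds]
  intro ε hε
  obtain ⟨n, hn⟩ := exists_nat_one_div_lt hε
  filter_upwards [hω n] with k hk
  exact hk.trans hn

end Consistency

/-! ### Asymptotic normality for a fixed parameter -/

section AsymptoticNormality

variable {X : Type*} [MeasurableSpace X] {μ : Measure X} {V : X → ℝ → ℂ} {S : Set ℝ}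

theorem exists_mem_uIcc_sub_eq_mul {G G' : ℝ → ℝ} {a b : ℝ}
    (h : ∀ x ∈ Set.uIcc a b, HasDerivAt G (G' x) x) :
    ∃ c ∈ Set.uIcc a b, G b - G a = G' c * (b - a) := by
  have key : ∀ a b : ℝ, a < b → (∀ x ∈ Set.uIcc a b, HasDerivAt G (G' x) x) →
      ∃ c ∈ Set.uIcc a b, G b - G a = G' c * (b - a) := fun a b hab h => by
    rw [Set.uIcc_of_le hab.le] at h ⊢
    obtain ⟨c, hc, hc'⟩ := exists_hasDerivAt_eq_slope G G' hab
      (fun x hx => (h x hx).continuousAt.continuousWithinAt)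
      (fun x hx => h x (Set.Ioo_subset_Icc_self hx))
    refine ⟨c, Set.Ioo_subset_Icc_self hc, ?_⟩
    rw [hc', div_mul_cancel₀ _ (sub_pos.2 hab).ne']
  rcases lt_trichotomy a b with hab | rfl | hab
  · exact key a b hab h
  · exact ⟨a, by simp, by simp⟩
  · rw [Set.uIcc_comm] at h ⊢
    obtain ⟨c, hc, hc'⟩ := key b a hab h
    exact ⟨c, hc, by linarith⟩

/-- The normalised score of the first `k` outcomes. -/
def scoreSum (V : X → ℝ → ℂ) (ν : ℝ) (k : ℕ) (ω : ℕ → X) : ℝ :=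
  (Real.sqrt k)⁻¹ * ∑ j ∈ Finset.range k, deriv (logLik V (ω j)) ν

/-- Expansion of the likelihood equation at the true parameter. -/
theorem exists_scoreSum_eq (hC : CLTAssumption μ V S) {est : ℕ → (ℕ → X) → ℝ}
    (hE : IsMLE V S est) {ν r : ℝ} (hr : 0 < r) (hball : Metric.ball ν r ⊆ S) {k : ℕ} (hk : 0 < k)
    {ω : ℕ → X} (hest : |est k ω - ν| < r) :
    ∃ ν' ∈ S, |ν' - ν| ≤ |est k ω - ν| ∧ scoreSum V ν k ω =
      -((1 / (k : ℝ)) * ∑ j ∈ Finset.range k, iteratedDeriv 2 (logLik V (ω j)) ν') *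
        (Real.sqrt k * (est k ω - ν)) := by
  have hk' : (0 : ℝ) < k := Nat.cast_pos.2 hk
  have hmem : est k ω ∈ Metric.ball ν r := hest
  let G : ℝ → ℝ := fun a => ∑ j ∈ Finset.range k, deriv (logLik V (ω j)) a
  let G' : ℝ → ℝ := fun a => ∑ j ∈ Finset.range k, iteratedDeriv 2 (logLik V (ω j)) a
  have hG : ∀ a ∈ S, HasDerivAt G (G' a) a := fun a ha =>
    HasDerivAt.fun_sum fun j _ => by
      rw [hC.iteratedDeriv_two_logLik _ ha]
      exact hC.hasDerivAt_deriv_logLik _ ha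
  have hL : HasDerivAt (fun a => ∑ j ∈ Finset.range k, logLik V (ω j) a) (G (est k ω))
      (est k ω) := HasDerivAt.fun_sum fun j _ => by
    have hs := hE.mem k ω
    rw [hC.deriv_logLik _ hs]
    exact hC.hasDerivAt_logLik _ (hC.pos _ hs _)
  -- The estimator lies in a ball inside `S`, so its maximality over `S` is a local maximum on the
  -- line and the score vanishes there.
  have hmax : IsLocalMax (fun a => ∑ j ∈ Finset.range k, logLik V (ω j) a) (est k ω) := by
    filter_upwards [Metric.isOpen_ball.mem_nhds hmem] with a ha
    have := hE.isMax k ω a (hball ha)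
    exact le_of_mul_le_mul_left this (by positivity)
  have h0 : G (est k ω) = 0 := hmax.hasDerivAt_eq_zero hL
  have hsub : Set.uIcc ν (est k ω) ⊆ Metric.ball ν r :=
    (convex_ball ν r).ordConnected.uIcc_subset (Metric.mem_ball_self hr) hmem
  obtain ⟨c, hc, hc'⟩ := exists_mem_uIcc_sub_eq_mul (G := G) (G' := G')
    (fun x hx => hG x (hball (hsub hx)))
  refine ⟨c, hball (hsub hc), Set.abs_sub_left_of_mem_uIcc hc, ?_⟩
  have hs : Real.sqrt k ≠ 0 := (Real.sqrt_pos.2 hk').ne'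
  have hss : Real.sqrt k * Real.sqrt k = k := Real.mul_self_sqrt hk'.le
  have e : G ν = -(G' c * (est k ω - ν)) := by linarith
  change (Real.sqrt k)⁻¹ * G ν = -((1 / (k : ℝ)) * G' c) * (Real.sqrt k * (est k ω - ν))
  have e2 : 1 / (k : ℝ) * Real.sqrt k = (Real.sqrt k)⁻¹ := by
    rw [one_div, inv_mul_eq_iff_eq_mul₀ hk'.ne', ← div_eq_mul_inv, eq_div_iff hs, hss]
  rw [e, ← e2]
  ring

open Classical in
/-- The ratio of the normalised score and the normalised error of the estimator. -/
def curvatureRatio (μ : Measure X) (V : X → ℝ → ℂ) (est : ℕ → (ℕ → X) → ℝ) (ν : ℝ) (k : ℕ)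
    (ω : ℕ → X) : ℝ :=
  if Real.sqrt k * (est k ω - ν) = 0 then fisher μ V ν
  else scoreSum V ν k ω / (Real.sqrt k * (est k ω - ν))

theorem measurable_scoreSum (hV : IsJumpFamily μ V S) (hC : CLTAssumption μ V S) {ν : ℝ}
    (hν : ν ∈ S) (k : ℕ) : Measurable (scoreSum V ν k) :=
  (Finset.measurable_fun_sum _ fun j _ =>
    (hC.measurable_score hV hν).comp (measurable_pi_apply j)).const_mul _

theorem measurable_curvatureRatio (hV : IsJumpFamily μ V S) (hC : CLTAssumption μ V S)
    {est : ℕ → (ℕ → X) → ℝ} (hE : IsMLE V S est) {ν : ℝ} (hν : ν ∈ S) (k : ℕ) :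
    Measurable (curvatureRatio μ V est ν k) := by
  have h1 : Measurable fun ω => Real.sqrt k * (est k ω - ν) :=
    ((hE.measurable k).sub_const ν).const_mul _
  exact Measurable.ite (h1 (measurableSet_singleton 0)) measurable_const
    ((measurable_scoreSum hV hC hν k).div h1)

/-- Where the error is nonzero, the ratio is eventually minus the averaged second derivative at a
point between `ν` and the estimator; consistency and the local uniform law send it to `F(ν)`.
Working with the ratio avoids a measurable choice of that point. -/
theorem curvatureRatio_ae (hV : IsJumpFamily μ V S) (hL : LLNAssumption μ V S)
    (hC : CLTAssumption μ V S) (hS : IsCompact S) {est : ℕ → (ℕ → X) → ℝ} (hE : IsMLE V S est)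
    {ν : ℝ} (hν : ν ∈ interior S) [IsProbabilityMeasure (condLaw μ V ν)] :
    ∀ᵐ ω ∂(Measure.infinitePi fun _ : ℕ => condLaw μ V ν),
      Tendsto (fun k => curvatureRatio μ V est ν k ω) atTop (𝓝 (fisher μ V ν)) ∧
      ∀ᶠ k : ℕ in atTop, scoreSum V ν k ω * (curvatureRatio μ V est ν k ω)⁻¹ =
        Real.sqrt k * (est k ω - ν) := by
  have hνS := interior_subset hν
  obtain ⟨r, hr, hball⟩ := Metric.mem_nhds_iff.1 (mem_interior_iff_mem_nhds.1 hν)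
  obtain ⟨g, hg, hgb⟩ := hC.dominated ν hνS
  choose δ hδ hae using fun n : ℕ => exists_delta_average_near (condLaw μ V ν) (S := S)
    (h := fun ξ => iteratedDeriv 2 (logLik V ξ))
    (fun a ha => hC.measurable_iteratedDeriv_logLik hV ha) hC.continuousOn_iteratedDeriv_two hg
    (fun ξ a ha => (hgb 2 (by simp) ξ a ha).le) hνS (ε := 1 / ((n : ℝ) + 1))
    Nat.one_div_pos_of_nat
  rw [hC.fisher_eq hV hνS] at hae
  filter_upwards [ae_all_iff.2 hae, tendsto_mle_ae hV hL hC hS hE hνS] with ω h1 h2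
  have hT : Tendsto (fun k => curvatureRatio μ V est ν k ω) atTop (𝓝 (fisher μ V ν)) := by
    rw [Metric.tendsto_nhds]
    intro ε hε
    obtain ⟨n, hn⟩ := exists_nat_one_div_lt hε
    filter_upwards [h1 n, Metric.tendsto_nhds.1 h2 (min r (δ n)) (lt_min hr (hδ n)),
      eventually_gt_atTop 0] with k hk1 hk2 hk3
    rw [Real.dist_eq] at hk2 ⊢
    unfold curvatureRatio
    split_ifs with hz
    · simpa using hε
    · obtain ⟨ν', hν'S, hν', he⟩ := exists_scoreSum_eq hC hE hr hball hk3
        (hk2.trans_le (min_le_left _ _))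
      rw [he, mul_div_cancel_right₀ _ hz]
      have := hk1 ν' hν'S (hν'.trans_lt (hk2.trans_le (min_le_right _ _)))
      rw [← abs_neg, neg_sub, sub_neg_eq_add, add_comm, ← sub_neg_eq_add]
      exact this.trans hn
  refine ⟨hT, ?_⟩
  have hF := hC.fisher_pos hV hνS
  filter_upwards [hT.eventually_ne hF.ne', Metric.tendsto_nhds.1 h2 r hr, eventually_gt_atTop 0]
    with k hk1 hk2 hk3
  by_cases hz : Real.sqrt k * (est k ω - ν) = 0
  -- A zero error forces a zero score, so the default value of the ratio is harmless.
  · obtain ⟨ν', -, -, he⟩ := exists_scoreSum_eq hC hE hr hball hk3 hk2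
    rw [hz, mul_zero] at he
    rw [he, hz, zero_mul]
  · unfold curvatureRatio at hk1 ⊢
    rw [if_neg hz] at hk1 ⊢
    have : scoreSum V ν k ω ≠ 0 := fun h => hk1 (by rw [h, zero_div])
    field_simp

theorem limitNormal_map_mul {ν : ℝ} (hF : 0 < fisher μ V ν) :
    (limitNormal μ V ν).map (fun x => fisher μ V ν * x) =
      gaussianReal 0 (fisher μ V ν).toNNReal := by
  rw [limitNormal, gaussianReal_map_const_mul, mul_zero]
  congr 1
  ext
  push_cast
  rw [Real.coe_toNNReal _ (inv_nonneg.2 hF.le), Real.coe_toNNReal _ hF.le]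
  field_simp

instance instIsProbabilityMeasureLimitNormal (ν : ℝ) :
    IsProbabilityMeasure (limitNormal μ V ν) := by
  unfold limitNormal
  infer_instance

/-- The scores are centred with variance `F(ν)`. Writing the limit `N(0, F)` as `F` times an `N(0,
F⁻¹)` variable lets the later factor `F⁻¹` leave exactly that variable. -/
theorem tendstoInDistribution_scoreSum (hV : IsJumpFamily μ V S) (hC : CLTAssumption μ V S)
    {ν : ℝ} (hν : ν ∈ S) [IsProbabilityMeasure (condLaw μ V ν)] :
    TendstoInDistribution (scoreSum V ν) atTop (fun x => fisher μ V ν * x)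
      (fun _ => Measure.infinitePi fun _ : ℕ => condLaw μ V ν) (limitNormal μ V ν) := by
  have hm := hC.measurable_score hV hν
  have h0 := identDistrib_comp_eval (condLaw μ V ν) hm
  have hvar : Var[fun ω : ℕ → X => deriv (logLik V (ω 0)) ν;
      Measure.infinitePi fun _ : ℕ => condLaw μ V ν] = fisher μ V ν := by
    rw [(h0 0).variance_eq, variance_of_integral_eq_zero hm.aemeasurable (hC.integral_score hV hν)]
    rfl
  have hY : HasLaw (fun x => fisher μ V ν * x) (gaussianReal 0
      Var[fun ω : ℕ → X => deriv (logLik V (ω 0)) ν;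
        Measure.infinitePi fun _ : ℕ => condLaw μ V ν].toNNReal) (limitNormal μ V ν) := by
    rw [hvar]
    exact ⟨by fun_prop, limitNormal_map_mul (hC.fisher_pos hV hν)⟩
  have := tendstoInDistribution_inv_sqrt_mul_sum_sub
    (X := fun (i : ℕ) (ω : ℕ → X) => deriv (logLik V (ω i)) ν) hY
    ((h0 0).memLp_iff.2 (hC.score_memLp ν hν)) (iIndepFun_comp_eval (condLaw μ V ν) hm)
    (fun i => (h0 i).trans (h0 0).symm)
  rw [(h0 0).integral_eq, hC.integral_score hV hν] at this
  simp only [mul_zero, sub_zero] at this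
  exact this

/-- Asymptotic normality of the maximum likelihood estimator for independent outcomes. -/
theorem tendstoInDistribution_mle (hV : IsJumpFamily μ V S) (hL : LLNAssumption μ V S)
    (hC : CLTAssumption μ V S) (hS : IsCompact S) {est : ℕ → (ℕ → X) → ℝ} (hE : IsMLE V S est)
    {ν : ℝ} (hν : ν ∈ interior S) [IsProbabilityMeasure (condLaw μ V ν)] :
    TendstoInDistribution (fun (k : ℕ) ω => Real.sqrt k * (est k ω - ν)) atTop (id : ℝ → ℝ)
      (fun _ => Measure.infinitePi fun _ : ℕ => condLaw μ V ν) (limitNormal μ V ν) := by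
  have hνS := interior_subset hν
  have hF := hC.fisher_pos hV hνS
  have hae := curvatureRatio_ae hV hL hC hS hE hν
  have hmc := measurable_curvatureRatio hV hC hE hνS
  have hms := measurable_scoreSum hV hC hνS
  have hmT : ∀ k : ℕ, Measurable fun ω => Real.sqrt k * (est k ω - ν) := fun k =>
    ((hE.measurable k).sub_const ν).const_mul _
  have h1 : TendstoInMeasure (Measure.infinitePi fun _ : ℕ => condLaw μ V ν)
      (fun k ω => (curvatureRatio μ V est ν k ω)⁻¹) atTop (fun _ => (fisher μ V ν)⁻¹) := by
    refine tendstoInMeasure_of_tendsto_ae (fun k => (hmc k).inv.aestronglyMeasurable) ?_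
    filter_upwards [hae] with ω hω
    exact hω.1.inv₀ hF.ne'
  -- Slutsky: the score converges in law, the inverse ratio in probability to a constant.
  have h2 := (tendstoInDistribution_scoreSum hV hC
    hνS).continuous_comp_prodMk_of_tendstoInMeasure_const (g := fun p : ℝ × ℝ => p.1 * p.2)
    (by fun_prop) h1 (fun k => (hmc k).inv.aemeasurable)
  have e : (fun x => fisher μ V ν * x * (fisher μ V ν)⁻¹) = (id : ℝ → ℝ) := by
    funext x
    simp only [id]
    field_simp
  simp only [e] at h2
  refine tendstoInDistribution_of_tendstoInMeasure_sub _ _ h2 ?_ fun k => (hmT k).aemeasurable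
  refine tendstoInMeasure_of_tendsto_ae
    (fun k => ((hmT k).sub ((hms k).mul (hmc k).inv)).aestronglyMeasurable) ?_
  filter_upwards [hae] with ω hω
  refine tendsto_const_nhds.congr' ?_
  filter_upwards [hω.2] with k hk
  simp only [Pi.zero_apply, Pi.sub_apply]
  rw [hk, sub_self]

end AsymptoticNormality

/-! ### Integrating the limits over the mixing measure -/

section Mixture

variable {X : Type*} [MeasurableSpace X] {μ : Measure X} {V : X → ℝ → ℂ} {S : Set ℝ}

theorem measurable_condLaw [SigmaFinite μ] (hV : IsJumpFamily μ V S) :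
    Measurable (condLaw μ V) := by
  refine Measure.measurable_of_measurable_coe _ fun s hs => ?_
  simp only [condLaw, withDensity_apply _ hs]
  have h : Measurable fun p : ℝ × X => ENNReal.ofReal (density V p.2 p.1) :=
    ((measurable_density hV.measurable).comp measurable_swap).ennreal_ofReal
  exact h.lintegral_prod_right'

theorem aemeasurable_limitNormal [SigmaFinite μ] (hV : IsJumpFamily μ V S)
    (hC : CLTAssumption μ V S) {m : Measure ℝ} (hm : ∀ᵐ ν ∂m, ν ∈ S) :
    AEMeasurable (limitNormal μ V) m := by
  have h1 := hC.measurable_deriv_density hV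
  have h2 := measurable_density hV.measurable
  -- A jointly measurable substitute for the Fisher integrand, agreeing with it for parameters in
  -- `S`.
  let φ : X × ℝ → ℝ := fun p =>
    density V p.1 p.2 * (deriv (density V p.1) p.2 / density V p.1 p.2) ^ 2
  have hφ : Measurable φ := h2.mul ((h1.div h2).pow_const 2)
  have hI : Measurable fun ν => ∫ ξ, φ (ξ, ν) ∂μ :=
    (hφ.stronglyMeasurable.integral_prod_left').measurable
  refine ⟨fun ν => gaussianReal 0 (Real.toNNReal (∫ ξ, φ (ξ, ν) ∂μ)⁻¹), ?_, ?_⟩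
  · exact measurable_gaussianReal.comp (measurable_const.prodMk hI.inv.real_toNNReal)
  · filter_upwards [hm] with ν hν
    rw [limitNormal, fisher, integral_condLaw hV]
    simp only [hC.deriv_logLik _ hν, φ]

/-- Almost sure and distributional limits of the estimators under a mixture of laws of independent
outcomes. -/
theorem mixture_limits [SigmaFinite μ] (hV : IsJumpFamily μ V S) (hL : LLNAssumption μ V S)
    (hC : CLTAssumption μ V S) (hS : IsCompact S) {est : ℕ → (ℕ → X) → ℝ} (hE : IsMLE V S est)
    {m : Measure ℝ} [IsProbabilityMeasure m] (hmS : ∀ᵐ ν ∂m, ν ∈ S) (hbd : m (frontier S) = 0)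
    {Q : ℝ → Measure X} [∀ ν, IsProbabilityMeasure (Q ν)] (hQm : Measurable Q)
    (hQ : ∀ ν ∈ S, Q ν = condLaw μ V ν) {P : Measure (ℕ → X)}
    (hP : P = m.bind fun ν => Measure.infinitePi fun _ : ℕ => Q ν) :
    ∃ Ninf : (ℕ → X) → ℝ, Measurable Ninf ∧
      (∀ᵐ ω ∂P, Tendsto (fun k => est k ω) atTop (𝓝 (Ninf ω))) ∧
      P.map Ninf = m ∧
      (∃ (_ : IsProbabilityMeasure P) (_ : IsProbabilityMeasure (m.bind (limitNormal μ V))),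
        TendstoInDistribution (fun (k : ℕ) ω => Real.sqrt k * (est k ω - Ninf ω)) atTop
          (id : ℝ → ℝ) (fun _ => P) (m.bind (limitNormal μ V))) ∧
      (∀ a : ℝ, Tendsto (fun k : ℕ => P.real {ω | Real.sqrt k * (est k ω - Ninf ω) ≤ a}) atTop
        (𝓝 (∫ ν in S, (limitNormal μ V ν).real (Set.Iic a) ∂m))) := by
  have hκ := measurable_infinitePi hQm
  have hlN := aemeasurable_limitNormal hV hC hmS
  have hPp : IsProbabilityMeasure P := hP ▸
    isProbabilityMeasure_bind hκ.aemeasurable (ae_of_all _ fun ν => inferInstance)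
  have hbp : IsProbabilityMeasure (m.bind (limitNormal μ V)) :=
    isProbabilityMeasure_bind hlN (ae_of_all _ fun ν => inferInstance)
  -- The limsup is measurable and defined without reference to `ν`, yet recovers `ν` under almost
  -- every component.
  let Ninf : (ℕ → X) → ℝ := fun ω => limsup (fun k => est k ω) atTop
  have hNm : Measurable Ninf := Measurable.limsup hE.measurable
  have hcons : ∀ᵐ ν ∂m, ∀ᵐ ω ∂(Measure.infinitePi fun _ : ℕ => Q ν),
      Tendsto (fun k => est k ω) atTop (𝓝 ν) := by
    filter_upwards [hmS] with ν hν
    have hp : IsProbabilityMeasure (condLaw μ V ν) := hQ ν hν ▸ inferInstance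
    rw [hQ ν hν]
    exact tendsto_mle_ae hV hL hC hS hE hν
  have hNinf : ∀ᵐ ν ∂m, ∀ᵐ ω ∂(Measure.infinitePi fun _ : ℕ => Q ν), Ninf ω = ν := by
    filter_upwards [hcons] with ν hν
    filter_upwards [hν] with ω hω
    exact hω.limsup_eq
  have hT : ∀ k : ℕ, Measurable fun ω => Real.sqrt k * (est k ω - Ninf ω) := fun k =>
    ((hE.measurable k).sub hNm).const_mul _
  have hdist : ∀ᵐ ν ∂m,
      TendstoInDistribution (fun (k : ℕ) ω => Real.sqrt k * (est k ω - Ninf ω)) atTop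
        (id : ℝ → ℝ) (fun _ => Measure.infinitePi fun _ : ℕ => Q ν) (limitNormal μ V ν) := by
    have hint : ∀ᵐ ν ∂m, ν ∉ frontier S := measure_eq_zero_iff_ae_notMem.1 hbd
    filter_upwards [hmS, hint, hNinf] with ν hν hfr hN
    have hi : ν ∈ interior S := by
      by_contra hcon
      exact hfr ⟨subset_closure hν, hcon⟩
    have hp : IsProbabilityMeasure (condLaw μ V ν) := hQ ν hν ▸ inferInstance
    simp only [hQ ν hν] at hN ⊢
    refine (tendstoInDistribution_mle hV hL hC hS hE hi).congr (fun k => ?_) (ae_eq_refl _)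
    filter_upwards [hN] with ω hω
    rw [hω]
  refine ⟨Ninf, hNm, ?_, ?_, ⟨hPp, hbp, ⟨fun k => (hT k).aemeasurable, aemeasurable_id, ?_⟩⟩, ?_⟩
  · have hms : MeasurableSet {ω | Tendsto (fun k => est k ω) atTop (𝓝 (Ninf ω))} :=
      measurableSet_tendsto_fun hE.measurable hNm
    rw [ae_iff]
    change P {ω | Tendsto (fun k => est k ω) atTop (𝓝 (Ninf ω))}ᶜ = 0
    rw [hP, Measure.bind_apply hms.compl hκ.aemeasurable]
    refine lintegral_eq_zero_of_ae_eq_zero ?_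
    filter_upwards [hcons, hNinf] with ν h1 h2
    change (Measure.infinitePi fun _ : ℕ => Q ν) _ = 0
    rw [← mem_ae_iff]
    filter_upwards [h1, h2] with ω hω1 hω2
    rw [hω2]
    exact hω1
  · ext B hB
    rw [Measure.map_apply hNm hB, hP, Measure.bind_apply (hNm hB) hκ.aemeasurable]
    rw [← lintegral_indicator_one hB]
    refine lintegral_congr_ae ?_
    filter_upwards [hNinf] with ν hν
    by_cases hνB : ν ∈ B
    · rw [Set.indicator_of_mem hνB, Pi.one_apply, ← mem_ae_iff_prob_eq_one (hNm hB)]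
      filter_upwards [hν] with ω hω
      simpa [hω] using hνB
    · rw [Set.indicator_of_notMem hνB, measure_eq_zero_iff_ae_notMem]
      filter_upwards [hν] with ω hω
      simpa [hω] using hνB
  · refine ProbabilityMeasure.tendsto_iff_forall_lintegral_tendsto.2 fun f => ?_
    have hf : Measurable fun x => (f x : ℝ≥0∞) := f.continuous.measurable.coe_nnreal_ennreal
    simp only [ProbabilityMeasure.coe_mk, Measure.map_id]
    have e1 : ∀ k : ℕ, ∫⁻ x, f x ∂(P.map fun ω => Real.sqrt k * (est k ω - Ninf ω)) =
        ∫⁻ ν, ∫⁻ x, f x ∂((Measure.infinitePi fun _ : ℕ => Q ν).map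
          fun ω => Real.sqrt k * (est k ω - Ninf ω)) ∂m := fun k => by
      simp only [lintegral_map hf (hT k)]
      rw [hP]
      exact Measure.lintegral_bind hκ.aemeasurable (hf.comp (hT k)).aemeasurable
    simp only [e1]
    rw [Measure.lintegral_bind hlN hf.aemeasurable]
    refine tendsto_lintegral_of_dominated_convergence' (fun _ => (nndist 0 f : ℝ≥0∞)) (fun k => ?_)
      (fun k => ?_) (by simp) ?_
    · simp only [lintegral_map hf (hT k)]
      exact ((Measure.measurable_lintegral (hf.comp (hT k))).comp hκ).aemeasurable
    · refine ae_of_all _ fun ν => ?_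
      have : IsProbabilityMeasure ((Measure.infinitePi fun _ : ℕ => Q ν).map
          fun ω => Real.sqrt k * (est k ω - Ninf ω)) :=
        Measure.isProbabilityMeasure_map (hT k).aemeasurable
      refine (lintegral_mono fun x => ENNReal.coe_le_coe.2 (f.apply_le_nndist_zero x)).trans ?_
      rw [lintegral_const, measure_univ, mul_one]
    · filter_upwards [hdist] with ν hν
      have := ProbabilityMeasure.tendsto_iff_forall_lintegral_tendsto.1 hν.tendsto f
      simpa only [ProbabilityMeasure.coe_mk, Measure.map_id] using this
  · intro a
    have hset : ∀ k : ℕ, MeasurableSet {ω | Real.sqrt k * (est k ω - Ninf ω) ≤ a} := fun k =>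
      measurableSet_le (hT k) measurable_const
    have hlim : Tendsto (fun k : ℕ => P {ω | Real.sqrt k * (est k ω - Ninf ω) ≤ a}) atTop
        (𝓝 (∫⁻ ν, limitNormal μ V ν (Set.Iic a) ∂m)) := by
      simp only [hP, Measure.bind_apply (hset _) hκ.aemeasurable]
      refine tendsto_lintegral_of_dominated_convergence' (fun _ => 1) (fun k => ?_)
        (fun k => ae_of_all _ fun ν => prob_le_one) (by simp) ?_
      · exact ((Measure.measurable_coe (hset k)).comp hκ).aemeasurable
      · filter_upwards [hdist, hmS] with ν hν hνS
        have hF := hC.fisher_pos hV hνS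
        -- Positive variance excludes atoms, so the half-line is a continuity set of the limit.
        have hna : NullSingletonClass (limitNormal μ V ν) :=
          nullSingletonClass_gaussianReal (by simpa using hF)
        have hfr : (limitNormal μ V ν).map id (frontier (Set.Iic a)) = 0 := by
          rw [frontier_Iic, Measure.map_id]
          simp
        have := ProbabilityMeasure.tendsto_measure_of_null_frontier_of_tendsto' hν.tendsto
          (E := Set.Iic a) hfr
        simp only [ProbabilityMeasure.coe_mk, Measure.map_id] at this
        refine this.congr fun k => ?_
        rw [Measure.map_apply (hT k) measurableSet_Iic]
        rfl
    have hSr : m.restrict S = m := Measure.restrict_eq_self_of_ae_mem hmS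
    have he : ∫ ν in S, (limitNormal μ V ν).real (Set.Iic a) ∂m =
        (∫⁻ ν, limitNormal μ V ν (Set.Iic a) ∂m).toReal := by
      rw [hSr]
      refine integral_toReal ?_ (ae_of_all _ fun ν => measure_lt_top _ _)
      exact (Measure.measurable_coe measurableSet_Iic).comp_aemeasurable hlN
    rw [he]
    refine (ENNReal.tendsto_toReal ?_).comp hlim
    refine ne_top_of_le_ne_top ENNReal.one_ne_top ?_
    refine (lintegral_mono fun ν => prob_le_one).trans ?_
    simp

end Mixture

end

end NonDemolition


theorem theorem2p3
    {H : Type*} [NormedAddCommGroup H] [InnerProductSpace ℂ H] [CompleteSpace H]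
    [TopologicalSpace.SeparableSpace H]
    {X : Type*} [MeasurableSpace X] (μ : Measure X) [SigmaFinite μ]
    (N : H →L[ℂ] H) (hN : IsSelfAdjoint N)
    (ρ : H →L[ℂ] H) (hρ : NonDemolition.IsDensityMatrix ρ)
    (V : X → ℝ → ℂ) (hV : NonDemolition.IsJumpFamily μ V (spectrum ℝ N))
    (hLLN : NonDemolition.LLNAssumption μ V (spectrum ℝ N))
    (hCLT : NonDemolition.CLTAssumption μ V (spectrum ℝ N))
    (hbd : NonDemolition.spectralMeasure N ρ (frontier (spectrum ℝ N)) = 0)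
    (Nhat : ℕ → (ℕ → X) → ℝ) (hMLE : NonDemolition.IsMLE V (spectrum ℝ N) Nhat) :
    ∃ Ninf : (ℕ → X) → ℝ, Measurable Ninf ∧
      -- `Ninf` is the almost sure limit of the estimators, with law `λ_ρ`
      (∀ᵐ ω ∂(NonDemolition.outcomeLaw μ N V ρ),
        Tendsto (fun k => Nhat k ω) atTop (𝓝 (Ninf ω))) ∧
      (NonDemolition.outcomeLaw μ N V ρ).map Ninf = NonDemolition.spectralMeasure N ρ ∧
      -- convergence in distribution to the mixture of the laws `N(0, F(ν)⁻¹)`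
      (∃ (_ : IsProbabilityMeasure (NonDemolition.outcomeLaw μ N V ρ))
        (_ : IsProbabilityMeasure
          ((NonDemolition.spectralMeasure N ρ).bind (NonDemolition.limitNormal μ V))),
        TendstoInDistribution (fun (k : ℕ) ω => Real.sqrt k * (Nhat k ω - Ninf ω)) atTop
          (id : ℝ → ℝ) (fun _ => NonDemolition.outcomeLaw μ N V ρ)
          ((NonDemolition.spectralMeasure N ρ).bind (NonDemolition.limitNormal μ V))) ∧
      -- convergence of the distribution functions
      (∀ a : ℝ, Tendsto
        (fun k : ℕ => (NonDemolition.outcomeLaw μ N V ρ).real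
          {ω | Real.sqrt k * (Nhat k ω - Ninf ω) ≤ a}) atTop
        (𝓝 (∫ ν in spectrum ℝ N, (NonDemolition.limitNormal μ V ν).real (Set.Iic a)
          ∂(NonDemolition.spectralMeasure N ρ)))) := by
  classical
  have hmp := NonDemolition.isProbabilityMeasure_spectralMeasure hN hρ
  have hmS := NonDemolition.spectralMeasure_ae_mem hN hρ
  have hSm : MeasurableSet (spectrum ℝ N) := (spectrum.isClosed (𝕜 := ℝ) N).measurableSet
  obtain ⟨ν₀, hν₀⟩ := hmS.exists
  -- Off the spectrum `condLaw` need not be a probability measure; retracting to the spectrum gives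
  -- a probability kernel on all of `ℝ`, unchanged where `λ_ρ` lives.
  let r : ℝ → ℝ := fun ν => if ν ∈ spectrum ℝ N then ν else ν₀
  have hr : ∀ ν, r ν ∈ spectrum ℝ N := fun ν => by
    simp only [r]
    split_ifs with h
    · exact h
    · exact hν₀
  have hrm : Measurable r := Measurable.ite hSm measurable_id measurable_const
  have hQp : ∀ ν, IsProbabilityMeasure (NonDemolition.condLaw μ V (r ν)) := fun ν =>
    NonDemolition.isProbabilityMeasure_condLaw hV hLLN (hr ν)
  have hQm : Measurable fun ν => NonDemolition.condLaw μ V (r ν) :=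
    (NonDemolition.measurable_condLaw hV).comp hrm
  have hQ : ∀ ν ∈ spectrum ℝ N,
      NonDemolition.condLaw μ V (r ν) = NonDemolition.condLaw μ V ν := fun ν hν => by
    simp only [r, if_pos hν]
  exact NonDemolition.mixture_limits hV hLLN hCLT (spectrum.isCompact N) hMLE hmS hbd hQm hQ
    (NonDemolition.outcomeLaw_eq_bind hN hρ hV hQm hQ)
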